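/- Let $s\in(0,1)$, $n\in\mathbb N$ with $n>2s$, and let $\Omega\subset\mathbb R^n$ be open and bounded. Let $K:\mathbb R^n\setminus\{0\}\to(0,+\infty)$ satisfy $\min\{|x|^2,1\}K\in L^1(\mathbb R^n)$ and, for some $\theta>0$, $K(x)\ge\theta|x|^{-(n+2s)}$ for all $x\ne0$. Let $X_0$ be the space of Lebesgue measurable $g:\mathbb R^n\to\mathbb R$ (modulo a.e. equality) such that $g|_\Omega\in L^2(\Omega)$, $(x,y)\mapsto(g(x)-g(y))\sqrt{K(x-y)}$ is in $L^2\big((\mathbb R^n\times\mathbb R^n)\setminus((\mathbb R^n\setminus\Omega)\times(\mathbb R^n\setminus\Omega))\big)$ and $g=0$ a.e. in $\mathbb R^n\setminus\Omega$, with the norm $\|g\|_{X_0}=\big(\int_{\mathbb R^n\times\mathbb R^n}|g(x)-g(y)|^2K(x-y)\,dx\,dy\big)^{1/2}$ and the corresponding scalar product. Let $f:\overline\Omega\times\mathbb R\to\mathbb R$ and $F(x,t)=\int_0^tf(x,\tau)\,d\tau$. Assume: 1. $f\in C(\overline\Omega\times\mathbb R)$; 2. there are $a_1,a_2>0$ and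 $q\in(2,2^*)$, $2^*=2n/(n-2s)$, with $|f(x,t)|\le a_1+a_2|t|^{q-1}$ for all $x\in\Omega$, $t\in\mathbb R$; 3. $\lim_{|t|\to+\infty}F(x,t)/|t|^2=+\infty$ uniformly for $x\in\overline\Omega$; 4. there is $\bar t>0$ such that for every $x\in\Omega$ the function $t\mapsto f(x,t)/t$ is (not necessarily strictly) increasing on $[\bar t,+\infty)$ and (not necessarily strictly) decreasing on $(-\infty,-\bar t]$. For $\lambda\in\mathbb R$ and $u\in X_0$ put $$\mathcal J_{K,\lambda}(u)=\frac12\int_{\mathbb R^n\times\mathbb R^n}|u(x)-u(y)|^2K(x-y)\,dx\,dy-\frac\lambda2\int_\Omega|u(x)|^2\,dx-\int_\Omega F(x,u(x))\,dx .$$ Then for every $\lambda\in\mathbb R$ the functional $\mathcal J_{K,\lambda}:X_0\to\mathbb R$ is well defined (all integrals converge absolutely) and Fréchet differentiable, and it satisfies the Cerami condition at every level $c\in\mathbb R$: every sequence $(u_j)$ in $X_0$ with $\mathcal J_{K,\lambda}(u_j)\to c$ and $$(1+\|u_j\|_{X_0})\,\sup\big\{|\langle\mathcal J_{K,\lambda}'(u_j),\varphi\rangle|:\varphi\in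 X_0,\ \|\varphi\|_{X_0}=1\big\}\to0$$ has a subsequence that converges strongly in $X_0$. -/

import Mathlib

open MeasureTheory Filter Topology

noncomputable section

namespace Nonlocal

/-- Euclidean space `ℝⁿ`. -/
abbrev E (n : ℕ) : Type := EuclideanSpace ℝ (Fin n)

/-- Standing assumptions on the order `s`, the dimension `n`, the domain `Ω` and the kernel `K`.
The kernel lives on `ℝⁿ ∖ {0}`; its value at `0` plays no role. -/
structure Setting (n : ℕ) (s : ℝ) (Ω : Set (E n)) (K : E n → ℝ) : Prop where
  s_pos : 0 < s
  s_lt_one : s < 1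
  two_s_lt : 2 * s < n
  isOpen : IsOpen Ω
  isBounded : Bornology.IsBounded Ω
  kernel_pos : ∀ x, x ≠ 0 → 0 < K x
  kernel_integrable : Integrable (fun x => min (‖x‖ ^ 2) 1 * K x)
  kernel_lower : ∃ θ : ℝ, 0 < θ ∧ ∀ x, x ≠ 0 → θ * ‖x‖ ^ (-((n : ℝ) + 2 * s)) ≤ K x

variable {n : ℕ} {s : ℝ} {Ω : Set (E n)} {K : E n → ℝ}

/-- The map `(x, y) ↦ (g(x) - g(y)) √K(x - y)`. -/
def incr (K : E n → ℝ) (g : E n → ℝ) (p : E n × E n) : ℝ :=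
  (g p.1 - g p.2) * √(K (p.1 - p.2))

/-- Membership in `X`: a Lebesgue measurable function on `ℝⁿ` whose restriction to `Ω` is in
`L²(Ω)` and whose weighted increments are in `L²((ℝⁿ × ℝⁿ) ∖ (Ωᶜ × Ωᶜ))`. -/
structure MemX (Ω : Set (E n)) (K : E n → ℝ) (g : E n → ℝ) : Prop where
  measurable : AEMeasurable g volume
  memLp : MemLp g 2 (volume.restrict Ω)
  incr_memLp : MemLp (incr K g) 2 (volume.restrict ((Ωᶜ ×ˢ Ωᶜ)ᶜ))

/-- Membership in `X₀`: in `X` and vanishing a.e. outside `Ω`. -/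
structure MemX0 (Ω : Set (E n)) (K : E n → ℝ) (g : E n → ℝ) : Prop extends MemX Ω K g where
  zero_outside : ∀ᵐ x, x ∉ Ω → g x = 0

theorem incr_congr {g h : E n → ℝ} (hgh : g =ᵐ[volume] h) :
    incr K g =ᵐ[volume] incr K h := by
  have h1 := (Measure.quasiMeasurePreserving_fst (μ := (volume : Measure (E n)))
    (ν := (volume : Measure (E n)))).ae hgh
  have h2 := (Measure.quasiMeasurePreserving_snd (μ := (volume : Measure (E n)))
    (ν := (volume : Measure (E n)))).ae hgh
  rw [Measure.volume_eq_prod]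
  filter_upwards [h1, h2] with p hp1 hp2
  simp only [incr, hp1, hp2]

theorem MemX0.congr {g h : E n → ℝ} (hg : MemX0 Ω K g) (hgh : g =ᵐ[volume] h) :
    MemX0 Ω K h where
  measurable := hg.measurable.congr hgh
  memLp := (memLp_congr_ae (ae_restrict_of_ae hgh)).1 hg.memLp
  incr_memLp := (memLp_congr_ae (ae_restrict_of_ae (incr_congr hgh))).1 hg.incr_memLp
  zero_outside := by
    filter_upwards [hg.zero_outside, hgh] with x h1 h2 hx
    rw [← h2, h1 hx]

theorem MemX0.add {g h : E n → ℝ} (hg : MemX0 Ω K g) (hh : MemX0 Ω K h) :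
    MemX0 Ω K (g + h) where
  measurable := hg.measurable.add hh.measurable
  memLp := hg.memLp.add hh.memLp
  incr_memLp := by
    have e : incr K (g + h) = incr K g + incr K h := by
      funext p; simp only [incr, Pi.add_apply]; ring
    rw [e]; exact hg.incr_memLp.add hh.incr_memLp
  zero_outside := by
    filter_upwards [hg.zero_outside, hh.zero_outside] with x h1 h2 hx
    simp [h1 hx, h2 hx]

theorem MemX0.const_smul {g : E n → ℝ} (c : ℝ) (hg : MemX0 Ω K g) : MemX0 Ω K (c • g) where
  measurable := hg.measurable.const_smul c
  memLp := hg.memLp.const_smul c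
  incr_memLp := by
    have e : incr K (c • g) = c • incr K g := by
      funext p; simp only [incr, Pi.smul_apply, smul_eq_mul]; ring
    rw [e]; exact hg.incr_memLp.const_smul c
  zero_outside := by
    filter_upwards [hg.zero_outside] with x h1 hx
    simp [h1 hx]

theorem memX0_zero : MemX0 Ω K (0 : E n → ℝ) where
  measurable := aemeasurable_const
  memLp := MemLp.zero'
  incr_memLp := by
    have e : incr K (0 : E n → ℝ) = fun _ => (0 : ℝ) := by
      funext p; simp [incr]
    rw [e]; exact MemLp.zero'
  zero_outside := by simp

/-- The linear space `X₀`, functions being identified when they agree a.e. -/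
def X0Submodule (Ω : Set (E n)) (K : E n → ℝ) : Submodule ℝ (E n →ₘ[volume] ℝ) where
  carrier := {g | MemX0 Ω K g}
  add_mem' {g h} hg hh := (hg.add hh).congr (AEEqFun.coeFn_add g h).symm
  zero_mem' := memX0_zero.congr AEEqFun.coeFn_zero.symm
  smul_mem' c g hg := (MemX0.const_smul c hg).congr (AEEqFun.coeFn_smul c g).symm

/-- The space `X₀` as a type; it carries the standing assumptions, which make the quadratic form
below positive definite. -/
def X0 (_h : Setting n s Ω K) : Type := X0Submodule Ω K

variable {h : Setting n s Ω K}

instance : AddCommGroup (X0 h) := inferInstanceAs (AddCommGroup (X0Submodule Ω K))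

instance : Module ℝ (X0 h) := inferInstanceAs (Module ℝ (X0Submodule Ω K))

/-- An element of `X₀` as a function on `ℝⁿ` (a representative of its a.e. class). -/
instance : CoeFun (X0 h) (fun _ => E n → ℝ) := ⟨fun u => (u.1 : E n →ₘ[volume] ℝ)⟩

/-- Every function with the defining properties of `X₀` gives an element of `X₀`. -/
def X0.mk (h : Setting n s Ω K) (g : E n → ℝ) (hg : MemX0 Ω K g) : X0 h :=
  ⟨AEEqFun.mk g hg.measurable.aestronglyMeasurable, hg.congr (AEEqFun.coeFn_mk g _).symm⟩

theorem X0.coe_mk (g : E n → ℝ) (hg : MemX0 Ω K g) : ⇑(X0.mk h g hg) =ᵐ[volume] g :=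
  AEEqFun.coeFn_mk g _

theorem X0.memX0 (u : X0 h) : MemX0 Ω K u := u.2

theorem X0.coe_add (u v : X0 h) : ⇑(u + v) =ᵐ[volume] ⇑u + ⇑v :=
  AEEqFun.coeFn_add u.1 v.1

theorem X0.coe_smul (c : ℝ) (u : X0 h) : ⇑(c • u) =ᵐ[volume] c • ⇑u :=
  AEEqFun.coeFn_smul c u.1

/-- The bilinear form `∫∫ (u(x) - u(y)) (v(x) - v(y)) K(x - y) dx dy`. -/
def form (K : E n → ℝ) (u v : E n → ℝ) : ℝ :=
  ∫ p : E n × E n, (u p.1 - u p.2) * (v p.1 - v p.2) * K (p.1 - p.2)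

theorem X0.incr_memLp (u : X0 h) : MemLp (incr K u) 2 (volume : Measure (E n × E n)) := by
  have hm : MeasurableSet ((Ωᶜ ×ˢ Ωᶜ)ᶜ : Set (E n × E n)) :=
    (h.isOpen.measurableSet.compl.prod h.isOpen.measurableSet.compl).compl
  have h0 := (memLp_indicator_iff_restrict hm).2 u.memX0.incr_memLp
  refine (memLp_congr_ae ?_).1 h0
  have h1 := (Measure.quasiMeasurePreserving_fst (μ := (volume : Measure (E n)))
    (ν := (volume : Measure (E n)))).ae u.memX0.zero_outside
  have h2 := (Measure.quasiMeasurePreserving_snd (μ := (volume : Measure (E n)))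
    (ν := (volume : Measure (E n)))).ae u.memX0.zero_outside
  rw [Measure.volume_eq_prod]
  filter_upwards [h1, h2] with p hp1 hp2
  by_cases hp : p ∈ ((Ωᶜ ×ˢ Ωᶜ)ᶜ : Set (E n × E n))
  · simp [Set.indicator_of_mem hp]
  · rw [Set.indicator_of_notMem hp]
    simp only [Set.mem_compl_iff, not_not, Set.mem_prod] at hp
    simp [incr, hp1 hp.1, hp2 hp.2]

theorem integrand_eq (h : Setting n s Ω K) (u v : E n → ℝ) (p : E n × E n) :
    (u p.1 - u p.2) * (v p.1 - v p.2) * K (p.1 - p.2) = incr K u p * incr K v p := by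
  by_cases hp : p.1 = p.2
  · simp [incr, hp]
  · have hK := Real.mul_self_sqrt (h.kernel_pos _ (sub_ne_zero.2 hp)).le
    calc _ = (u p.1 - u p.2) * (v p.1 - v p.2) * (√(K (p.1 - p.2)) * √(K (p.1 - p.2))) := by
          rw [hK]
      _ = _ := by simp only [incr]; ring

theorem X0.integrable (u v : X0 h) : Integrable
    (fun p : E n × E n => (u p.1 - u p.2) * (v p.1 - v p.2) * K (p.1 - p.2)) := by
  simp only [integrand_eq h]
  exact u.incr_memLp.integrable_mul v.incr_memLp

theorem form_congr {u u' v v' : E n → ℝ} (hu : u =ᵐ[volume] u') (hv : v =ᵐ[volume] v')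
    (h : Setting n s Ω K) : form K u v = form K u' v' := by
  simp only [form, integrand_eq h]
  refine integral_congr_ae ?_
  filter_upwards [incr_congr (K := K) hu, incr_congr (K := K) hv] with p h1 h2
  rw [h1, h2]

theorem X0.eq_zero_of_form (u : X0 h) (hu : form K u u = 0) : u = 0 := by
  have hn : 0 < n := by
    have h1 := h.two_s_lt
    have h2 := h.s_pos
    have : (0 : ℝ) < n := by linarith
    exact_mod_cast this
  have : Nonempty (Fin n) := ⟨⟨0, hn⟩⟩
  have hvol : volume (Ωᶜ) ≠ 0 := by
    intro h0
    have h1 : (volume : Measure (E n)) Set.univ = ⊤ := measure_univ_of_isAddLeftInvariant _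
    have h2 : (volume : Measure (E n)) Set.univ ≤ volume Ω + volume Ωᶜ := by
      rw [← Set.union_compl_self Ω]; exact measure_union_le _ _
    rw [h1, h0, add_zero] at h2
    exact absurd h.isBounded.measure_lt_top (not_lt.2 h2)
  simp only [form, integrand_eq h] at hu
  have hi : Integrable (fun p : E n × E n => incr K u p * incr K u p) :=
    u.incr_memLp.integrable_mul u.incr_memLp
  rw [integral_eq_zero_iff_of_nonneg (fun p => mul_self_nonneg _) hi,
    Measure.volume_eq_prod] at hu
  have h3 := Measure.ae_ae_of_ae_prod hu
  have h4 : ⇑u =ᵐ[volume] 0 := by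
    filter_upwards [h3] with x hx
    have h5 : ∀ᵐ y : E n, y ≠ x := by simp [ae_iff]
    by_contra hne
    apply hvol
    have h6 : ∀ᵐ y : E n, y ∉ Ωᶜ := by
      filter_upwards [hx, h5, u.memX0.zero_outside] with y hy1 hy2 hy3 hy4
      have hK := Real.sqrt_pos.2 (h.kernel_pos (x - y) (sub_ne_zero.2 (Ne.symm hy2)))
      have hy5 : incr K u (x, y) = 0 := mul_self_eq_zero.1 hy1
      simp only [incr, hy3 hy4, sub_zero, mul_eq_zero, hK.ne', or_false] at hy5
      exact hne hy5
    exact measure_eq_zero_iff_ae_notMem.2 h6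
  exact Subtype.ext (AEEqFun.ext (h4.trans AEEqFun.coeFn_zero.symm))

/-- The scalar product `⟨u, v⟩ = ∫∫ (u(x) - u(y)) (v(x) - v(y)) K(x - y) dx dy` of `X₀`. -/
abbrev X0.core (h : Setting n s Ω K) : InnerProductSpace.Core ℝ (X0 h) where
  inner u v := form K u v
  conj_inner_symm u v := by
    simp only [form, conj_trivial]
    congr 1; funext p; ring
  re_inner_nonneg u := by
    simp only [form, RCLike.re_to_real, integrand_eq h]
    exact integral_nonneg fun p => mul_self_nonneg _
  add_left u v w := by
    rw [form_congr (X0.coe_add u v) (ae_eq_refl _) h]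
    simp only [form, ← integral_add (u.integrable w) (v.integrable w)]
    congr 1; funext p; simp only [Pi.add_apply]; ring
  smul_left u v c := by
    rw [form_congr (X0.coe_smul c u) (ae_eq_refl _) h]
    simp only [form, conj_trivial, ← integral_const_mul]
    congr 1; funext p; simp only [Pi.smul_apply, smul_eq_mul]; ring
  definite u hu := u.eq_zero_of_form hu

instance : NormedAddCommGroup (X0 h) := (X0.core h).toNormedAddCommGroup

instance : InnerProductSpace ℝ (X0 h) := InnerProductSpace.ofCore (X0.core h).toCore

/-- The norm of `X₀` is `(∫∫ |u(x) - u(y)|² K(x - y) dx dy)^{1/2}`. -/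
theorem X0.norm_eq (u : X0 h) :
    ‖u‖ = √(∫ p : E n × E n, |u p.1 - u p.2| ^ 2 * K (p.1 - p.2)) := by
  have e : ‖u‖ = √(form K u u) := rfl
  rw [e]; simp only [form, sq_abs]; simp only [sq]

/-- The primitive `F(x, t) = ∫₀ᵗ f(x, τ) dτ`. -/
def primitive (f : E n → ℝ → ℝ) (x : E n) (t : ℝ) : ℝ := ∫ τ in (0 : ℝ)..t, f x τ

/-- The energy functional `J_{K,λ}` on `X₀`. -/
def energy (h : Setting n s Ω K) (lam : ℝ) (f : E n → ℝ → ℝ) (u : X0 h) : ℝ :=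
  1 / 2 * (∫ p : E n × E n, |u p.1 - u p.2| ^ 2 * K (p.1 - p.2))
    - lam / 2 * (∫ x in Ω, |u x| ^ 2) - ∫ x in Ω, primitive f x (u x)

/-- The Cerami compactness condition at level `c` for a functional `J` on a normed space:
every sequence `u_j` with `J(u_j) → c` and
`(1 + ‖u_j‖) sup {|⟨J'(u_j), φ⟩| : ‖φ‖ = 1} → 0` has a strongly convergent subsequence. -/
def CeramiCondition {V : Type*} [NormedAddCommGroup V] [NormedSpace ℝ V] (J : V → ℝ) (c : ℝ) :
    Prop :=
  ∀ u : ℕ → V, Tendsto (fun j => J (u j)) atTop (𝓝 c) →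
    Tendsto (fun j => (1 + ‖u j‖) * sSup {r : ℝ | ∃ φ : V, ‖φ‖ = 1 ∧ r = |fderiv ℝ J (u j) φ|})
      atTop (𝓝 0) →
    ∃ (k : ℕ → ℕ) (v : V), StrictMono k ∧ Tendsto (fun j => u (k j)) atTop (𝓝 v)

/-- Subcritical growth: `|f(x,t)| ≤ a₁ + a₂ |t|^{q-1}` with `2 < q < 2* = 2n/(n-2s)`. -/
def SubcriticalGrowth (s : ℝ) (Ω : Set (E n)) (f : E n → ℝ → ℝ) : Prop :=
  ∃ a₁ a₂ q : ℝ, 0 < a₁ ∧ 0 < a₂ ∧ 2 < q ∧ q < 2 * n / (n - 2 * s) ∧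
    ∀ x ∈ Ω, ∀ t : ℝ, |f x t| ≤ a₁ + a₂ * |t| ^ (q - 1)

/-- `F(x,t)/|t|² → +∞` as `|t| → +∞`, uniformly for `x` in the closure of `Ω`. -/
def Superquadratic (Ω : Set (E n)) (f : E n → ℝ → ℝ) : Prop :=
  ∀ M : ℝ, ∃ R : ℝ, 0 < R ∧ ∀ x ∈ closure Ω, ∀ t : ℝ, R ≤ |t| →
    M ≤ primitive f x t / |t| ^ 2

/-- There is `t̄ > 0` such that for all `x ∈ Ω` the map `t ↦ f(x,t)/t` is (weakly) increasing on
`[t̄, ∞)` and (weakly) decreasing on `(-∞, -t̄]`. -/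
def EventuallyMonotoneRatio (Ω : Set (E n)) (f : E n → ℝ → ℝ) : Prop :=
  ∃ b : ℝ, 0 < b ∧ ∀ x ∈ Ω,
    MonotoneOn (fun t => f x t / t) (Set.Ici b) ∧ AntitoneOn (fun t => f x t / t) (Set.Iic (-b))

end Nonlocal

end

/-! Write the energy as ½‖u‖² − (λ/2)‖Pu‖² − Φ(Qu), where P and Q embed X₀ into L²(Ω) and L^q(Ω),
and Φ(w) = ∫_Ω F(x, w). The proof separates an abstract Hilbert space argument about such
functionals (`ceramiCondition_potentialEnergy`) from the analysis that supplies its hypotheses.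

Boundedness of a Cerami sequence (`exists_norm_le_of_cerami`) is the heart. If ‖w_j‖ → ∞, put v_j =
w_j/‖w_j‖. Since Φ dominates every multiple of ‖P·‖² up to a constant and the energies are bounded,
P v_j → 0; interpolation between L² and the critical exponent gives Q v_j → 0. Hence J(r v_j) → r²/2
− Φ(0) for each fixed r. Monotonicity of f(x,t)/t for large |t| gives J(aw) ≤ J(w) − (1−a²)/2
⟨J'(w), w⟩ + C for 0 ≤ a ≤ 1, with C independent of w. Taking a = r/‖w_j‖, and using ⟨J'(w_j), w_j⟩
→ 0 (this is what the weight 1 + ‖w_j‖ provides), yields r²/2 − Φ(0) ≤ c + C for every r > 0, which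
is absurd.

A bounded sequence has a subsequence whose images under P and Q converge. Testing J'(x) − J'(y)
against x − y bounds ‖x − y‖² by quantities tending to zero, so this subsequence is Cauchy
(`exists_tendsto_subseq_of_bounded`).

The analytic input is the fractional Sobolev inequality (`exists_sobolev`), obtained by integrating
a pointwise bound; compactness in L²(Ω), because averaging over small balls is of finite rank and
uniformly close to the identity on bounded sets (`isCompactOperator_toLp_two`); completeness of X₀;
and differentiability of Φ on L^q, from dominated convergence and Hölder's inequality
(`PowerGrowth.hasFDerivAt_potential`). -/

open scoped ENNReal

noncomputable section

namespace Nonlocal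

/-! ### The fractional Sobolev inequality. -/

section

variable {n : ℕ} {s : ℝ} {Ω : Set (E n)} {K : E n → ℝ}

/-- The density `x ↦ ∫ |u(x) - u(y)|² |x - y|^{-σ} dy` of the Gagliardo seminorm. -/
def gagliardo (σ : ℝ) (u : E n → ℝ) (x : E n) : ℝ≥0∞ :=
  ∫⁻ y, ENNReal.ofReal (|u x - u y| ^ 2 * ‖x - y‖ ^ (-σ))

theorem volume_ball_eq (x : E n) {r : ℝ} (hr : 0 < r) :
    volume (Metric.ball x r) =
      ENNReal.ofReal ((volume (Metric.ball (0 : E n) 1)).toReal * r ^ n) := by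
  have h1 := Measure.addHaar_ball_of_pos (volume : Measure (E n)) x hr
  rw [h1, finrank_euclideanSpace_fin, mul_comm (ENNReal.toReal _),
    ENNReal.ofReal_mul (by positivity), ENNReal.ofReal_toReal measure_ball_lt_top.ne]

theorem volume_unit_ball_pos : 0 < (volume (Metric.ball (0 : E n) 1)).toReal :=
  ENNReal.toReal_pos (Metric.measure_ball_pos _ _ one_pos).ne' measure_ball_lt_top.ne

/-- A lower bound for the Gagliardo density in terms of the size of a set on which `u` is at most
half its value at `x`. -/
theorem le_gagliardo {σ : ℝ} (hσ : 0 ≤ σ) (u : E n → ℝ) (x : E n) {r m : ℝ} (hr : 0 < r)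
    {G : Set (E n)} (hG : MeasurableSet G) (hm : ENNReal.ofReal m ≤ volume G)
    (hball : G ⊆ Metric.ball x r) (hsmall : ∀ y ∈ G, |u y| < |u x| / 2) :
    ENNReal.ofReal ((|u x| / 2) ^ 2 * r ^ (-σ) * m) ≤ gagliardo σ u x := by
  have hc : 0 ≤ (|u x| / 2) ^ 2 * r ^ (-σ) := by positivity
  calc ENNReal.ofReal ((|u x| / 2) ^ 2 * r ^ (-σ) * m)
      = ENNReal.ofReal ((|u x| / 2) ^ 2 * r ^ (-σ)) * ENNReal.ofReal m := ENNReal.ofReal_mul hc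
    _ ≤ ENNReal.ofReal ((|u x| / 2) ^ 2 * r ^ (-σ)) * volume G := by gcongr
    _ = ∫⁻ _ in G, ENNReal.ofReal ((|u x| / 2) ^ 2 * r ^ (-σ)) := by rw [setLIntegral_const]
    _ ≤ ∫⁻ y in G, ENNReal.ofReal (|u x - u y| ^ 2 * ‖x - y‖ ^ (-σ)) := by
        refine setLIntegral_mono' hG fun y hy => ENNReal.ofReal_le_ofReal ?_
        have h1 := hsmall y hy
        have h2 : |u x| / 2 ≤ |u x - u y| := by
          have := abs_sub_abs_le_abs_sub (u x) (u y)
          linarith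
        -- The strict bound on G excludes y = x, where the comparison of negative powers would break
        -- down.
        have hne : x ≠ y := by
          rintro rfl
          have := abs_nonneg (u x)
          linarith
        have h3 : 0 < ‖x - y‖ := norm_pos_iff.2 (sub_ne_zero.2 hne)
        have h4 : ‖x - y‖ ≤ r := by
          have := hball hy
          rw [Metric.mem_ball, dist_comm, dist_eq_norm] at this
          exact this.le
        have h5 : r ^ (-σ) ≤ ‖x - y‖ ^ (-σ) :=
          Real.rpow_le_rpow_of_nonpos h3 h4 (by linarith)
        gcongr
    _ ≤ _ := setLIntegral_le_lintegral _ _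

/-- Points of a ball at which `u` is small fill half the ball as soon as the radius is large
compared with the `L^p` mass of `u`. -/
theorem volume_small_ge {u : E n → ℝ} (hu : Measurable u) {p : ℝ} (hp : 0 < p) {A : ℝ}
    (hA : ∫⁻ x, ENNReal.ofReal (|u x| ^ p) ≤ ENNReal.ofReal A) (x : E n) {a r : ℝ} (ha : 0 < a)
    (hr : 0 < r) {m : ℝ} (hm : 0 ≤ m)
    (hball : (volume (Metric.ball (0 : E n) 1)).toReal * r ^ n = 2 * m) (hm' : A / a ^ p ≤ m) :
    ENNReal.ofReal m ≤ volume (Metric.ball x r ∩ {y | |u y| < a}) := by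
  have hap : 0 < a ^ p := Real.rpow_pos_of_pos ha p
  have h1 : volume {y | a ≤ |u y|} ≤ ENNReal.ofReal m := by
    have h2 := mul_meas_ge_le_lintegral (μ := (volume : Measure (E n)))
      (f := fun x => ENNReal.ofReal (|u x| ^ p)) (by fun_prop) (ENNReal.ofReal (a ^ p))
    have h3 : {y | a ≤ |u y|} ⊆ {y | ENNReal.ofReal (a ^ p) ≤ ENNReal.ofReal (|u y| ^ p)} :=
      fun y hy => ENNReal.ofReal_le_ofReal (Real.rpow_le_rpow ha.le hy hp.le)
    have h4 : ENNReal.ofReal (a ^ p) * volume {y | a ≤ |u y|} ≤ ENNReal.ofReal A :=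
      ((mul_le_mul_right (measure_mono h3) _).trans h2).trans hA
    have h5 : volume {y | a ≤ |u y|} ≤ ENNReal.ofReal A / ENNReal.ofReal (a ^ p) := by
      rw [ENNReal.le_div_iff_mul_le (by simp [hap]) (by simp), mul_comm]
      exact h4
    refine h5.trans ?_
    rw [← ENNReal.ofReal_div_of_pos hap]
    exact ENNReal.ofReal_le_ofReal hm'
  have h6 : volume (Metric.ball x r) ≤
      volume (Metric.ball x r ∩ {y | |u y| < a}) + volume {y | a ≤ |u y|} := by
    refine (measure_mono fun y hy => ?_).trans (measure_union_le _ _)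
    rcases lt_or_ge (|u y|) a with h | h
    · exact Or.inl ⟨hy, h⟩
    · exact Or.inr h
  rw [volume_ball_eq x hr, hball, two_mul, ENNReal.ofReal_add hm hm] at h6
  exact (ENNReal.add_le_add_iff_right ENNReal.ofReal_ne_top).1 (h6.trans (by gcongr))

/-- The pointwise inequality behind the fractional Sobolev inequality. -/
theorem exists_rpow_le_gagliardo (hn : 0 < n) (hs : 0 < s) (h2s : 2 * s < n) :
    ∃ C : ℝ, 0 < C ∧ ∀ (u : E n → ℝ), Measurable u → ∀ A : ℝ, 0 < A →
      ∫⁻ x, ENNReal.ofReal (|u x| ^ (2 * n / (n - 2 * s))) ≤ ENNReal.ofReal A → ∀ x,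
      ENNReal.ofReal (|u x| ^ (2 * n / (n - 2 * s))) ≤
        ENNReal.ofReal (C * A ^ (2 * s / n)) * gagliardo (n + 2 * s) u x := by
  set κ := (volume (Metric.ball (0 : E n) 1)).toReal with hκ
  have hκ0 : 0 < κ := volume_unit_ball_pos
  set p : ℝ := 2 * n / (n - 2 * s) with hp
  have hn' : (0 : ℝ) < n := by exact_mod_cast hn
  have hp0 : 0 < p := div_pos (by linarith) (by linarith)
  -- The factor 8/κ combines the 1/4 from (|u x|/2)² with the ratio m / r^n = κ/2; the other factors
  -- come from r^(2s).
  refine ⟨(2 / κ) ^ (2 * s / n) * (2 ^ p) ^ (2 * s / n) * 8 / κ, by positivity,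
    fun u hu A hA huA x => ?_⟩
  rcases eq_or_ne (u x) 0 with h0 | h0
  · simp [h0, Real.zero_rpow hp0.ne']
  set a := |u x| with ha
  have ha0 : 0 < a := abs_pos.2 h0
  -- By Chebyshev's inequality m bounds the measure of {|u| ≥ a/2}. The radius r is chosen so that
  -- the ball has volume 2m, hence |u| < a/2 on at least half of it.
  set m : ℝ := A / (a / 2) ^ p with hm
  have hm0 : 0 < m := by positivity
  set r : ℝ := (2 * m / κ) ^ (1 / (n : ℝ)) with hr
  have hr0 : 0 < r := by positivity
  have hrn : r ^ n = 2 * m / κ := by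
    rw [hr, ← Real.rpow_natCast, ← Real.rpow_mul (by positivity)]
    rw [one_div, inv_mul_cancel₀ hn'.ne', Real.rpow_one]
  have h1 := volume_small_ge hu hp0 huA x (a := a / 2) (r := r) (by positivity) hr0 hm0.le
    (by rw [hrn, ← hκ, mul_div_cancel₀ _ hκ0.ne']) le_rfl
  have h2 := le_gagliardo (σ := n + 2 * s) (by positivity) u x hr0
    (measurableSet_ball.inter (measurableSet_lt hu.abs measurable_const)) h1
    Set.inter_subset_left (fun y hy => hy.2)
  refine le_trans ?_ (mul_le_mul_right h2 _)
  rw [← ENNReal.ofReal_mul (by positivity)]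
  refine ENNReal.ofReal_le_ofReal (le_of_eq ?_)
  have e1 : r ^ (-((n : ℝ) + 2 * s)) = (2 * m / κ)⁻¹ * ((2 * m / κ) ^ (2 * s / n))⁻¹ := by
    rw [hr, ← Real.rpow_mul (by positivity), ← Real.rpow_neg (by positivity),
      ← Real.rpow_neg_one, ← Real.rpow_add (by positivity)]
    congr 1
    field_simp
    ring
  have e2 : (2 * m / κ) ^ (2 * s / n) =
      (2 / κ) ^ (2 * s / n) * (A ^ (2 * s / n) * (2 ^ p) ^ (2 * s / n) / (a ^ p) ^ (2 * s / n)) := by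
    rw [← Real.mul_rpow (by positivity) (by positivity), ← Real.div_rpow (by positivity)
      (by positivity), ← Real.mul_rpow (by positivity) (by positivity), hm,
      Real.div_rpow ha0.le zero_le_two]
    congr 1
    field_simp
  -- This is p(1 − 2s/n) = 2, the relation that singles out the critical exponent.
  have e3 : a ^ p = a ^ 2 * (a ^ p) ^ (2 * s / n) := by
    rw [← Real.rpow_mul ha0.le, ← Real.rpow_natCast, ← Real.rpow_add ha0]
    congr 1
    have : (n : ℝ) - 2 * s ≠ 0 := by linarith
    rw [hp]
    push_cast
    field_simp
    ring
  rw [e1, e2, ← ha]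
  have hA' : 0 < A ^ (2 * s / n) := by positivity
  have hap' : 0 < (a ^ p) ^ (2 * s / n) := by positivity
  have h2p' : 0 < ((2 : ℝ) ^ p) ^ (2 * s / n) := by positivity
  have hκ' : 0 < ((2 : ℝ) / κ) ^ (2 * s / n) := by positivity
  generalize (a ^ p) ^ (2 * s / n) = X1 at *
  generalize ((2 : ℝ) ^ p) ^ (2 * s / n) = X2 at *
  generalize ((2 : ℝ) / κ) ^ (2 * s / n) = X3 at *
  generalize A ^ (2 * s / n) = X4 at *
  rw [e3]
  field_simp
  ring

/-- The fractional Sobolev inequality for functions with a finite critical norm. -/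
theorem exists_sobolev_of_finite (hn : 0 < n) (hs : 0 < s) (h2s : 2 * s < n) :
    ∃ C : ℝ, 0 < C ∧ ∀ (u : E n → ℝ), Measurable u →
      ∫⁻ x, ENNReal.ofReal (|u x| ^ (2 * n / (n - 2 * s))) ≠ ⊤ →
      (∫⁻ x, ENNReal.ofReal (|u x| ^ (2 * n / (n - 2 * s)))) ^ ((n - 2 * s) / n) ≤
        ENNReal.ofReal C * ∫⁻ x, gagliardo (n + 2 * s) u x := by
  obtain ⟨C, hC, H⟩ := exists_rpow_le_gagliardo hn hs h2s
  have hn' : (0 : ℝ) < n := by exact_mod_cast hn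
  refine ⟨C, hC, fun u hu hfin => ?_⟩
  set A := ∫⁻ x, ENNReal.ofReal (|u x| ^ (2 * n / (n - 2 * s))) with hA
  rcases eq_or_ne A 0 with h0 | h0
  · rw [h0, ENNReal.zero_rpow_of_pos (div_pos (by linarith) hn')]
    exact zero_le
  have hAr : 0 < A.toReal := ENNReal.toReal_pos h0 hfin
  have h1 : A ≤ ENNReal.ofReal (C * A.toReal ^ (2 * s / n)) *
      ∫⁻ x, gagliardo (n + 2 * s) u x := by
    rw [← lintegral_const_mul' _ _ ENNReal.ofReal_ne_top]
    exact lintegral_mono (H u hu A.toReal hAr (ENNReal.ofReal_toReal hfin).ge)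
  rw [ENNReal.ofReal_mul hC.le, ← ENNReal.ofReal_rpow_of_pos hAr, ENNReal.ofReal_toReal hfin] at h1
  have e : ((n : ℝ) - 2 * s) / n = 1 - 2 * s / n := by field_simp
  -- The integrated inequality has A on the left and A^(2s/n) on the right; dividing requires A to
  -- be nonzero and finite.
  rw [e, ENNReal.rpow_sub _ _ h0 hfin, ENNReal.rpow_one]
  refine ENNReal.div_le_of_le_mul (h1.trans (le_of_eq ?_))
  ring

/-- Truncation is 1-Lipschitz, so it does not increase the Gagliardo density. -/
theorem abs_truncate_sub_le (N a b : ℝ) :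
    |max (-N) (min a N) - max (-N) (min b N)| ≤ |a - b| := by
  rw [max_comm, max_comm (-N)]
  refine (abs_max_sub_max_le_abs _ _ _).trans ((abs_min_sub_min_le_max a N b N).trans ?_)
  simp

/-- The fractional Sobolev inequality for measurable functions vanishing a.e. outside a set of
finite measure. -/
theorem exists_sobolev (hn : 0 < n) (hs : 0 < s) (h2s : 2 * s < n) :
    ∃ C : ℝ, 0 < C ∧ ∀ (u : E n → ℝ), Measurable u →
      (∃ S : Set (E n), MeasurableSet S ∧ volume S ≠ ⊤ ∧ ∀ᵐ x, x ∉ S → u x = 0) →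
      eLpNorm u (ENNReal.ofReal (2 * n / (n - 2 * s))) volume ^ 2 ≤
        ENNReal.ofReal C * ∫⁻ x, gagliardo (n + 2 * s) u x := by
  obtain ⟨C, hC, H⟩ := exists_sobolev_of_finite hn hs h2s
  refine ⟨C, hC, fun u hu ⟨S, hS, hSfin, huS⟩ => ?_⟩
  set p : ℝ := 2 * n / (n - 2 * s) with hp
  have hn' : (0 : ℝ) < n := by exact_mod_cast hn
  have hp0 : 0 < p := div_pos (by linarith) (by linarith)
  -- Truncations are bounded and live on a set of finite measure, so their critical norm is finite
  -- and the previous inequality applies; Fatou's lemma removes the truncation.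
  set w : ℕ → E n → ℝ := fun N x => max (-(N : ℝ)) (min (u x) N) with hw
  have hwm : ∀ N, Measurable (w N) := fun N => by fun_prop
  have hlim : ∀ x, Tendsto (fun N => w N x) atTop (𝓝 (u x)) := fun x => by
    refine tendsto_const_nhds.congr' ?_
    obtain ⟨N₀, hN₀⟩ := exists_nat_ge |u x|
    filter_upwards [eventually_ge_atTop N₀] with N hN
    have h1 : |u x| ≤ N := hN₀.trans (by exact_mod_cast hN)
    rw [abs_le] at h1
    simp [hw, min_eq_left h1.2, max_eq_right h1.1]
  have hfin : ∀ N, ∫⁻ x, ENNReal.ofReal (|w N x| ^ p) ≠ ⊤ := fun N => by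
    have h1 : ∫⁻ x, ENNReal.ofReal (|w N x| ^ p) ≤
        ∫⁻ x, S.indicator (fun _ => ENNReal.ofReal ((N : ℝ) ^ p)) x := by
      refine lintegral_mono_ae ?_
      filter_upwards [huS] with x hx
      by_cases hxS : x ∈ S
      · rw [Set.indicator_of_mem hxS]
        refine ENNReal.ofReal_le_ofReal (Real.rpow_le_rpow (abs_nonneg _) ?_ hp0.le)
        have : (0 : ℝ) ≤ N := N.cast_nonneg
        rw [abs_le]
        exact ⟨le_max_left _ _, max_le (by linarith) (min_le_right _ _)⟩
      · simp [hw, hx hxS, Real.zero_rpow hp0.ne']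
    refine ne_top_of_le_ne_top ?_ h1
    rw [lintegral_indicator hS, setLIntegral_const]
    exact ENNReal.mul_ne_top ENNReal.ofReal_ne_top hSfin
  have hN : ∀ N, eLpNorm (w N) (ENNReal.ofReal p) volume ^ 2 ≤
      ENNReal.ofReal C * ∫⁻ x, gagliardo (n + 2 * s) u x := fun N => by
    have h1 := H (w N) (hwm N) (hfin N)
    have h2 : ∫⁻ x, gagliardo (n + 2 * s) (w N) x ≤ ∫⁻ x, gagliardo (n + 2 * s) u x := by
      refine lintegral_mono fun x => lintegral_mono fun y => ENNReal.ofReal_le_ofReal ?_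
      have := abs_truncate_sub_le N (u x) (u y)
      gcongr
    refine le_trans (le_of_eq ?_) (h1.trans (by gcongr))
    rw [eLpNorm_eq_lintegral_rpow_enorm_toReal (by simpa using hp0) ENNReal.ofReal_ne_top,
      ENNReal.toReal_ofReal hp0.le, ← ENNReal.rpow_natCast, ← ENNReal.rpow_mul]
    congr 1
    · refine lintegral_congr fun x => ?_
      rw [← ENNReal.ofReal_rpow_of_nonneg (abs_nonneg _) hp0.le, Real.enorm_eq_ofReal_abs]
    · have : (n : ℝ) - 2 * s ≠ 0 := by linarith
      rw [hp]; push_cast; field_simp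
  have h3 := Lp.eLpNorm_lim_le_liminf_eLpNorm (p := ENNReal.ofReal p) (μ := volume)
    (fun N => (hwm N).aestronglyMeasurable) u (ae_of_all _ hlim)
  set B := ENNReal.ofReal C * ∫⁻ x, gagliardo (n + 2 * s) u x
  have h4 : ∀ N, eLpNorm (w N) (ENNReal.ofReal p) volume ≤ B ^ (2⁻¹ : ℝ) := fun N => by
    rw [ENNReal.le_rpow_inv_iff (by norm_num)]
    exact_mod_cast hN N
  have h5 : eLpNorm u (ENNReal.ofReal p) volume ≤ B ^ (2⁻¹ : ℝ) :=
    h3.trans (liminf_le_of_le (by isBoundedDefault) fun b hb => by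
      obtain ⟨N, hN⟩ := hb.exists
      exact hN.trans (h4 N))
  rw [ENNReal.le_rpow_inv_iff (by norm_num)] at h5
  exact_mod_cast h5

end

/-! ### Continuous embeddings of X₀ into the spaces L^p(Ω). -/

section

variable {n : ℕ} {s : ℝ} {Ω : Set (E n)} {K : E n → ℝ}

theorem Setting.dim_pos (h : Setting n s Ω K) : 0 < n := by
  have h1 := h.two_s_lt
  have h2 := h.s_pos
  have : (0 : ℝ) < n := by linarith
  exact_mod_cast this

theorem Setting.volume_ne_top (h : Setting n s Ω K) : volume Ω ≠ ⊤ :=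
  h.isBounded.measure_lt_top.ne

theorem Setting.isFiniteMeasure_restrict (h : Setting n s Ω K) :
    IsFiniteMeasure (volume.restrict Ω) :=
  MeasureTheory.isFiniteMeasure_restrict.2 h.volume_ne_top

variable {h : Setting n s Ω K}

theorem X0.measurable (u : X0 h) : Measurable u := AEEqFun.measurable u.1

theorem X0.norm_sq (u : X0 h) :
    ‖u‖ ^ 2 = ∫ p : E n × E n, |u p.1 - u p.2| ^ 2 * K (p.1 - p.2) := by
  rw [X0.norm_eq, Real.sq_sqrt]
  refine integral_nonneg fun p => ?_
  have := integrand_eq h u u p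
  simp only [Pi.zero_apply]
  rw [sq_abs, sq, this]
  exact mul_self_nonneg _

theorem X0.norm_sq_eq_lintegral (u : X0 h) :
    ENNReal.ofReal (‖u‖ ^ 2) =
      ∫⁻ p : E n × E n, ENNReal.ofReal (|u p.1 - u p.2| ^ 2 * K (p.1 - p.2)) := by
  have e : (fun p : E n × E n => |u p.1 - u p.2| ^ 2 * K (p.1 - p.2)) =
      fun p => (u p.1 - u p.2) * (u p.1 - u p.2) * K (p.1 - p.2) := by
    funext p; rw [sq_abs, sq]
  rw [X0.norm_sq, ofReal_integral_eq_lintegral_ofReal]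
  · rw [e]; exact u.integrable u
  · refine ae_of_all _ fun p => ?_
    rw [e]
    simp only [Pi.zero_apply, integrand_eq h u u p]
    exact mul_self_nonneg _

/-- The Gagliardo seminorm is controlled by the norm of `X₀`. -/
theorem exists_lintegral_gagliardo_le (h : Setting n s Ω K) :
    ∃ C : ℝ, 0 < C ∧ ∀ u : X0 h,
      ∫⁻ x, gagliardo (n + 2 * s) u x ≤ ENNReal.ofReal (C * ‖u‖ ^ 2) := by
  obtain ⟨θ, hθ, hK⟩ := h.kernel_lower
  refine ⟨θ⁻¹, inv_pos.2 hθ, fun u => ?_⟩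
  have hu := u.measurable
  simp only [gagliardo]
  rw [lintegral_lintegral (f := fun x y =>
    ENNReal.ofReal (|u x - u y| ^ 2 * ‖x - y‖ ^ (-((n : ℝ) + 2 * s)))) (by fun_prop),
    ENNReal.ofReal_mul (inv_pos.2 hθ).le, X0.norm_sq_eq_lintegral,
    ← lintegral_const_mul' _ _ ENNReal.ofReal_ne_top, Measure.volume_eq_prod]
  refine lintegral_mono fun p => ?_
  rw [← ENNReal.ofReal_mul (inv_pos.2 hθ).le]
  refine ENNReal.ofReal_le_ofReal ?_
  rcases eq_or_ne p.1 p.2 with hp | hp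
  · simp [hp]
  · have h1 := hK _ (sub_ne_zero.2 hp)
    have h2 : ‖p.1 - p.2‖ ^ (-((n : ℝ) + 2 * s)) ≤ θ⁻¹ * K (p.1 - p.2) := by
      rw [inv_mul_eq_div, le_div_iff₀ hθ, mul_comm]; exact h1
    calc _ ≤ |u p.1 - u p.2| ^ 2 * (θ⁻¹ * K (p.1 - p.2)) := by gcongr
      _ = _ := by ring

/-- The critical Sobolev exponent `2* = 2n/(n-2s)`. -/
def critExp (n : ℕ) (s : ℝ) : ℝ≥0∞ := ENNReal.ofReal (2 * n / (n - 2 * s))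

theorem Setting.two_lt_crit (h : Setting n s Ω K) : 2 < 2 * (n : ℝ) / (n - 2 * s) := by
  have h1 := h.two_s_lt
  have h2 := h.s_pos
  rw [lt_div_iff₀ (by linarith)]
  linarith

theorem Setting.two_le_critExp (h : Setting n s Ω K) : 2 ≤ critExp n s := by
  rw [critExp, ← ENNReal.ofReal_ofNat]
  exact ENNReal.ofReal_le_ofReal h.two_lt_crit.le

/-- The continuous embedding of `X₀` into `L^p(Ω)` for `p` up to the critical exponent. -/
theorem exists_eLpNorm_le (h : Setting n s Ω K) {p : ℝ≥0∞} (hp : p ≤ critExp n s) :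
    ∃ C : ℝ, 0 ≤ C ∧ ∀ u : X0 h,
      eLpNorm u p (volume.restrict Ω) ≤ ENNReal.ofReal (C * ‖u‖) := by
  obtain ⟨C, hC, H⟩ := exists_sobolev h.dim_pos h.s_pos h.two_s_lt
  obtain ⟨C', hC', H'⟩ := exists_lintegral_gagliardo_le h
  have := h.isFiniteMeasure_restrict
  rcases eq_or_ne p 0 with rfl | hp0
  · exact ⟨0, le_rfl, fun u => by simp⟩
  set V := volume.restrict Ω Set.univ ^ (1 / p.toReal - 1 / (critExp n s).toReal) with hV
  have hVtop : V ≠ ⊤ := by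
    refine ENNReal.rpow_ne_top_of_nonneg (sub_nonneg.2 ?_) (measure_ne_top _ _)
    exact one_div_le_one_div_of_le (ENNReal.toReal_pos hp0 (ne_top_of_le_ne_top
      ENNReal.ofReal_ne_top hp)) (ENNReal.toReal_mono ENNReal.ofReal_ne_top hp)
  refine ⟨√(C * C') * V.toReal, by positivity, fun u => ?_⟩
  have h1 := H u u.measurable
    ⟨Ω, h.isOpen.measurableSet, h.volume_ne_top, u.memX0.zero_outside⟩
  have h2 : eLpNorm u (critExp n s) volume ≤ ENNReal.ofReal (√(C * C') * ‖u‖) := by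
    have h3 : eLpNorm u (critExp n s) volume ^ 2 ≤
        ENNReal.ofReal (√(C * C') * ‖u‖) ^ 2 := by
      refine h1.trans ((mul_le_mul_right (H' u) _).trans (le_of_eq ?_))
      rw [← ENNReal.ofReal_mul hC.le, ← ENNReal.ofReal_pow (by positivity), mul_pow,
        Real.sq_sqrt (by positivity), mul_assoc]
    exact (ENNReal.pow_le_pow_left_iff two_ne_zero).1 h3
  have h4 := eLpNorm_le_eLpNorm_mul_rpow_measure_univ (μ := volume.restrict Ω) hp
    u.measurable.aestronglyMeasurable
  refine h4.trans ?_
  rw [mul_right_comm, ENNReal.ofReal_mul (by positivity), ENNReal.ofReal_toReal hVtop]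
  gcongr
  exact (eLpNorm_mono_measure _ Measure.restrict_le_self).trans h2

theorem X0.memLp_restrict (u : X0 h) {p : ℝ≥0∞} (hp : p ≤ critExp n s) :
    MemLp u p (volume.restrict Ω) := by
  obtain ⟨C, -, H⟩ := exists_eLpNorm_le h hp
  exact ⟨u.measurable.aestronglyMeasurable, (H u).trans_lt ENNReal.ofReal_lt_top⟩

/-- The embedding `X₀ → L^p(Ω)` as a continuous linear map. -/
def X0.toLp (h : Setting n s Ω K) (p : ℝ≥0∞) [Fact (1 ≤ p)] (hp : p ≤ critExp n s) :
    X0 h →L[ℝ] Lp ℝ p (volume.restrict Ω) :=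
  LinearMap.mkContinuousOfExistsBound
    { toFun := fun u => (u.memLp_restrict hp).toLp u
      map_add' := fun u v => by
        rw [← MemLp.toLp_add]
        exact MemLp.toLp_congr _ _ (ae_restrict_of_ae (X0.coe_add u v))
      map_smul' := fun c u => by
        rw [RingHom.id_apply, ← MemLp.toLp_const_smul]
        exact MemLp.toLp_congr _ _ (ae_restrict_of_ae (X0.coe_smul c u)) }
    (by
      obtain ⟨C, hC, H⟩ := exists_eLpNorm_le h hp
      refine ⟨C, fun u => ?_⟩
      simp only [LinearMap.coe_mk, AddHom.coe_mk, Lp.norm_toLp]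
      exact ENNReal.toReal_le_of_le_ofReal (by positivity) (H u))

theorem X0.coeFn_toLp {p : ℝ≥0∞} [Fact (1 ≤ p)] (hp : p ≤ critExp n s) (u : X0 h) :
    X0.toLp h p hp u =ᵐ[volume.restrict Ω] u :=
  MemLp.coeFn_toLp (u.memLp_restrict hp)

/-! ### Compactness of the embeddings, by averaging over small balls. -/

theorem sq_lintegral_le {α : Type*} [MeasurableSpace α] (μ : Measure α) {g : α → ℝ≥0∞}
    (hg : AEMeasurable g μ) : (∫⁻ x, g x ∂μ) ^ 2 ≤ (∫⁻ x, g x ^ 2 ∂μ) * μ Set.univ := by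
  have h1 := ENNReal.lintegral_mul_le_Lp_mul_Lq μ Real.HolderConjugate.two_two hg
    (aemeasurable_const (b := (1 : ℝ≥0∞)))
  simp only [Pi.mul_apply, mul_one, lintegral_const, ENNReal.rpow_two] at h1
  refine (pow_le_pow_left' h1 2).trans (le_of_eq ?_)
  rw [mul_pow, ← ENNReal.rpow_natCast, ← ENNReal.rpow_natCast, ← ENNReal.rpow_mul,
    ← ENNReal.rpow_mul]
  norm_num

/-- Averages over small balls near `x` approximate `u(x)`. -/
theorem enorm_sub_average_sq_le {σ : ℝ} (hσ : 0 ≤ σ) {u : E n → ℝ} (hu : Measurable u)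
    {z x : E n} {d : ℝ} (hd : 0 < d) (hx : dist z x < d)
    (hint : IntegrableOn u (Metric.ball z d)) :
    ‖u x - (volume (Metric.ball z d)).toReal⁻¹ * ∫ y in Metric.ball z d, u y‖ₑ ^ 2 ≤
      ENNReal.ofReal ((2 * d) ^ σ / (volume (Metric.ball z d)).toReal) * gagliardo σ u x := by
  set B := Metric.ball z d with hB
  have hBtop : volume B ≠ ⊤ := measure_ball_lt_top.ne
  have hB0 : volume B ≠ 0 := (Metric.measure_ball_pos _ _ hd).ne'
  set V := (volume B).toReal with hV
  have hV0 : 0 < V := ENNReal.toReal_pos hB0 hBtop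
  have hVB : volume B = ENNReal.ofReal V := (ENNReal.ofReal_toReal hBtop).symm
  have e1 : u x - V⁻¹ * ∫ y in B, u y = V⁻¹ * ∫ y in B, (u x - u y) := by
    have hc : IntegrableOn (fun _ => u x) B := integrableOn_const hBtop
    rw [integral_sub hc hint, setIntegral_const, smul_eq_mul, measureReal_def, ← hV]
    field_simp
  have e2 : ‖V⁻¹ * ∫ y in B, (u x - u y)‖ₑ ≤ ENNReal.ofReal V⁻¹ * ∫⁻ y in B, ‖u x - u y‖ₑ := by
    rw [enorm_mul, Real.enorm_of_nonneg (inv_pos.2 hV0).le]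
    gcongr
    exact enorm_integral_le_lintegral_enorm _
  have e3 : (∫⁻ y in B, ‖u x - u y‖ₑ) ^ 2 ≤ (∫⁻ y in B, ‖u x - u y‖ₑ ^ 2) * volume B := by
    have := sq_lintegral_le (volume.restrict B) (g := fun y => ‖u x - u y‖ₑ) (by fun_prop)
    rwa [Measure.restrict_apply_univ] at this
  have e4 : ∫⁻ y in B, ‖u x - u y‖ₑ ^ 2 ≤ ENNReal.ofReal ((2 * d) ^ σ) * gagliardo σ u x := by
    rw [gagliardo, ← lintegral_const_mul' _ _ ENNReal.ofReal_ne_top]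
    refine le_trans (setLIntegral_mono' measurableSet_ball fun y hy => ?_)
      (setLIntegral_le_lintegral B _)
    rw [← ENNReal.ofReal_mul (by positivity), Real.enorm_eq_ofReal_abs,
      ← ENNReal.ofReal_pow (abs_nonneg _)]
    refine ENNReal.ofReal_le_ofReal ?_
    rcases eq_or_ne x y with rfl | hxy
    · simp
    have h1 : 0 < ‖x - y‖ := norm_pos_iff.2 (sub_ne_zero.2 hxy)
    have h2 : ‖x - y‖ ≤ 2 * d := by
      rw [← dist_eq_norm]
      have h3 := dist_triangle_left x y z
      have h4 : dist z y < d := by rw [dist_comm]; exact hy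
      linarith
    -- Both x and y lie within d of z, so the singular weight can be inserted at the cost of (2d)^σ.
    have h5 : 1 ≤ (2 * d) ^ σ * ‖x - y‖ ^ (-σ) := by
      rw [Real.rpow_neg h1.le, ← div_eq_mul_inv, one_le_div (by positivity)]
      exact Real.rpow_le_rpow h1.le h2 hσ
    nlinarith [sq_nonneg |u x - u y|]
  rw [e1]
  calc _ ≤ (ENNReal.ofReal V⁻¹ * ∫⁻ y in B, ‖u x - u y‖ₑ) ^ 2 := by gcongr
    _ = ENNReal.ofReal V⁻¹ ^ 2 * (∫⁻ y in B, ‖u x - u y‖ₑ) ^ 2 := mul_pow _ _ _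
    _ ≤ ENNReal.ofReal V⁻¹ ^ 2 *
        (ENNReal.ofReal ((2 * d) ^ σ) * gagliardo σ u x * ENNReal.ofReal V) := by
        rw [← hVB]; gcongr; exact e3.trans (by gcongr)
    _ = (ENNReal.ofReal V⁻¹ ^ 2 * ENNReal.ofReal ((2 * d) ^ σ) * ENNReal.ofReal V) *
        gagliardo σ u x := by ring
    _ = _ := by
        rw [← ENNReal.ofReal_pow (by positivity), ← ENNReal.ofReal_mul (by positivity),
          ← ENNReal.ofReal_mul (by positivity)]
        congr 2
        field_simp

/-- Total boundedness of Ω: finitely many points of a dense sequence are d-dense in it, and the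
nearest one is selected measurably. Finiteness of the range gives the averaging operator finite
rank. -/
theorem exists_simpleFunc_dist_lt (hΩ : Bornology.IsBounded Ω) {d : ℝ} (hd : 0 < d) :
    ∃ ν : SimpleFunc (E n) (E n), ∀ x ∈ Ω, dist (ν x) x < d := by
  set e := TopologicalSpace.denseSeq (E n)
  have hcover : closure Ω ⊆ ⋃ i, Metric.ball (e i) d := fun x _ => by
    obtain ⟨y, hy, i, rfl⟩ := (TopologicalSpace.denseRange_denseSeq (E n)).exists_dist_lt x hd |>.elim
      fun i hi => (⟨e i, hi, i, rfl⟩ : ∃ y, dist x y < d ∧ ∃ i, e i = y)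
    exact Set.mem_iUnion.2 ⟨i, hy⟩
  obtain ⟨t, ht⟩ := hΩ.isCompact_closure.elim_finite_subcover _
    (fun i => Metric.isOpen_ball) hcover
  refine ⟨SimpleFunc.nearestPt e (t.sup id), fun x hx => ?_⟩
  obtain ⟨i, hit, hi⟩ := Set.mem_iUnion₂.1 (ht (subset_closure hx))
  have h1 := SimpleFunc.edist_nearestPt_le e x (Finset.le_sup (f := id) hit)
  rw [edist_dist, edist_dist, ENNReal.ofReal_le_ofReal_iff dist_nonneg] at h1
  rw [Metric.mem_ball, dist_comm] at hi
  exact h1.trans_lt hi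

/-- The finite rank operator replacing a function on `Ω` by its averages over balls of radius `d`
centred at the values of `ν`. -/
def averageCLM (Ω : Set (E n)) (d : ℝ) (ν : SimpleFunc (E n) (E n))
    [IsFiniteMeasure (volume.restrict Ω)] :
    Lp ℝ 2 (volume.restrict Ω) →L[ℝ] Lp ℝ 2 (volume.restrict Ω) :=
  ∑ z ∈ ν.range, ((volume (Metric.ball z d)).toReal⁻¹ •
    innerSL ℝ (indicatorConstLp 2 (μ := volume.restrict Ω) (measurableSet_ball (x := z) (ε := d))
      (measure_ne_top _ _) (1 : ℝ))).smulRight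
    (indicatorConstLp 2 (μ := volume.restrict Ω) (ν.measurableSet_fiber z)
      (measure_ne_top _ _) (1 : ℝ))

/-- A rank one operator factors through ℝ, which is locally compact. -/
theorem isCompactOperator_smulRight {V W : Type*} [NormedAddCommGroup V] [NormedSpace ℝ V]
    [NormedAddCommGroup W] [NormedSpace ℝ W] (c : V →L[ℝ] ℝ) (w : W) :
    IsCompactOperator (c.smulRight w) :=
  (isCompactOperator_of_locallyCompactSpace_rng (ContinuousLinearMap.toSpanSingleton ℝ w)).comp_clm c

theorem isCompactOperator_averageCLM (Ω : Set (E n)) (d : ℝ) (ν : SimpleFunc (E n) (E n))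
    [IsFiniteMeasure (volume.restrict Ω)] : IsCompactOperator (averageCLM Ω d ν) := by
  rw [averageCLM]
  induction ν.range using Finset.induction_on with
  | empty => exact isCompactOperator_zero
  | insert z t hz ih =>
    rw [Finset.sum_insert hz]
    exact (isCompactOperator_smulRight _ _).add ih

theorem averageCLM_apply (d : ℝ) (ν : SimpleFunc (E n) (E n))
    [IsFiniteMeasure (volume.restrict Ω)] (w : Lp ℝ 2 (volume.restrict Ω)) :
    averageCLM Ω d ν w =ᵐ[volume.restrict Ω] fun x =>
      (volume (Metric.ball (ν x) d)).toReal⁻¹ *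
        ∫ y in Metric.ball (ν x) d, w y ∂(volume.restrict Ω) := by
  simp only [averageCLM, _root_.sum_apply, ContinuousLinearMap.smulRight_apply,
    _root_.smul_apply, innerSL_apply_apply, L2.inner_indicatorConstLp_one, smul_eq_mul]
  refine (Lp.coeFn_finsetSum _ _).trans ?_
  have h1 : ∀ z ∈ ν.range, ∀ᵐ x ∂(volume.restrict Ω),
      ((((volume (Metric.ball z d)).toReal⁻¹ *
        ∫ y in Metric.ball z d, w y ∂(volume.restrict Ω)) •
        indicatorConstLp 2 (μ := volume.restrict Ω) (ν.measurableSet_fiber z)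
          (measure_ne_top _ _) (1 : ℝ) : Lp ℝ 2 (volume.restrict Ω)) : E n → ℝ) x =
      ((volume (Metric.ball z d)).toReal⁻¹ *
        ∫ y in Metric.ball z d, w y ∂(volume.restrict Ω)) *
        (ν ⁻¹' {z}).indicator (fun _ => (1 : ℝ)) x := fun z _ => by
    filter_upwards [Lp.coeFn_smul ((volume (Metric.ball z d)).toReal⁻¹ *
        ∫ y in Metric.ball z d, w y ∂(volume.restrict Ω))
        (indicatorConstLp 2 (μ := volume.restrict Ω) (ν.measurableSet_fiber z)
          (measure_ne_top _ _) (1 : ℝ)),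
      indicatorConstLp_coeFn (p := 2) (μ := volume.restrict Ω) (hs := ν.measurableSet_fiber z)
        (hμs := measure_ne_top _ _) (c := (1 : ℝ))] with x hx1 hx2
    rw [hx1, Pi.smul_apply, hx2, smul_eq_mul]
  filter_upwards [(Finset.eventually_all ν.range).2 h1] with x hx
  rw [Finset.sum_apply, Finset.sum_congr rfl hx, Finset.sum_eq_single (ν x)]
  · simp
  · intro z _ hz
    rw [Set.indicator_of_notMem (by simpa using hz.symm), mul_zero]
  · intro hx
    exact absurd (ν.mem_range_self x) hx

/-- The averaging operator on L²(Ω) only sees B ∩ Ω, while the oscillation estimate concerns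
averages over the whole ball; the two agree because u vanishes outside Ω. -/
theorem X0.integral_restrict (u : X0 h) {B : Set (E n)} (hB : MeasurableSet B)
    {w : E n → ℝ} (hw : w =ᵐ[volume.restrict Ω] u) :
    ∫ y in B, w y ∂(volume.restrict Ω) = ∫ y in B, u y := by
  rw [integral_congr_ae (ae_restrict_of_ae hw), Measure.restrict_restrict hB, Set.inter_comm,
    ← Measure.restrict_restrict h.isOpen.measurableSet]
  refine setIntegral_eq_integral_of_ae_compl_eq_zero ?_
  exact ae_restrict_of_ae u.memX0.zero_outside

theorem X0.memLp_two (u : X0 h) : MemLp u 2 volume := by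
  refine (memLp_congr_ae ?_).1
    ((memLp_indicator_iff_restrict h.isOpen.measurableSet).2 u.memX0.memLp)
  filter_upwards [u.memX0.zero_outside] with x hx
  by_cases hxΩ : x ∈ Ω
  · rw [Set.indicator_of_mem hxΩ]
  · rw [Set.indicator_of_notMem hxΩ, hx hxΩ]

/-- Averaging over small balls is uniformly close to the identity on bounded subsets of `X₀`. -/
theorem exists_norm_toLp_sub_average_le (h : Setting n s Ω K) [IsFiniteMeasure (volume.restrict Ω)] :
    ∃ C : ℝ, 0 ≤ C ∧ ∀ d : ℝ, 0 < d → ∀ ν : SimpleFunc (E n) (E n),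
      (∀ x ∈ Ω, dist (ν x) x < d) → ∀ u : X0 h,
      ‖X0.toLp h 2 h.two_le_critExp u - averageCLM Ω d ν (X0.toLp h 2 h.two_le_critExp u)‖ ≤
        C * d ^ s * ‖u‖ := by
  obtain ⟨C, hC, H⟩ := exists_lintegral_gagliardo_le h
  have hs := h.s_pos
  set κ := (volume (Metric.ball (0 : E n) 1)).toReal with hκ
  have hκ0 : 0 < κ := volume_unit_ball_pos
  set A : ℝ := 2 ^ ((n : ℝ) + 2 * s) / κ * C with hA
  have hA0 : 0 ≤ A := by positivity
  refine ⟨√A, by positivity, fun d hd ν hν u => ?_⟩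
  set w := X0.toLp h 2 h.two_le_critExp u with hw
  have hwu : w =ᵐ[volume.restrict Ω] u := X0.coeFn_toLp _ u
  have hVd : ∀ z : E n, (volume (Metric.ball z d)).toReal = κ * d ^ n := fun z => by
    rw [volume_ball_eq z hd, ENNReal.toReal_ofReal (by positivity)]
  -- The volume of the ball cancels d^n and leaves d^(2s), which tends to zero with d.
  have hd2 : (2 * d) ^ ((n : ℝ) + 2 * s) / (κ * d ^ n) * C = A * (d ^ s) ^ 2 := by
    rw [hA, Real.mul_rpow zero_le_two hd.le, Real.rpow_add hd, Real.rpow_natCast,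
      ← Real.rpow_natCast (d ^ s), ← Real.rpow_mul hd.le, mul_comm s]
    push_cast
    field_simp
  have h1 : ∫⁻ x, ‖(w - averageCLM Ω d ν w : Lp ℝ 2 (volume.restrict Ω)) x‖ₑ ^ 2
      ∂(volume.restrict Ω) ≤ ENNReal.ofReal ((√A * d ^ s * ‖u‖) ^ 2) := by
    calc _ ≤ ∫⁻ x in Ω, ENNReal.ofReal ((2 * d) ^ ((n : ℝ) + 2 * s) / (κ * d ^ n)) *
          gagliardo (n + 2 * s) u x := by
          refine lintegral_mono_ae ?_
          filter_upwards [Lp.coeFn_sub w (averageCLM Ω d ν w), averageCLM_apply d ν w, hwu,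
            ae_restrict_mem h.isOpen.measurableSet] with x h1 h2 h3 h4
          rw [h1, Pi.sub_apply, h2, h3, u.integral_restrict measurableSet_ball hwu, ← hVd (ν x)]
          refine enorm_sub_average_sq_le (by positivity) u.measurable hd (hν x h4) ?_
          exact (u.memLp_two.locallyIntegrable one_le_two).integrableOn_isCompact
            (isCompact_closedBall (ν x) d) |>.mono_set Metric.ball_subset_closedBall
      _ ≤ ∫⁻ x, ENNReal.ofReal ((2 * d) ^ ((n : ℝ) + 2 * s) / (κ * d ^ n)) *
          gagliardo (n + 2 * s) u x := setLIntegral_le_lintegral _ _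
      _ ≤ ENNReal.ofReal ((2 * d) ^ ((n : ℝ) + 2 * s) / (κ * d ^ n)) *
          ENNReal.ofReal (C * ‖u‖ ^ 2) := by
          rw [lintegral_const_mul' _ _ ENNReal.ofReal_ne_top]
          gcongr
          exact H u
      _ = _ := by
          rw [← ENNReal.ofReal_mul (by positivity), ← mul_assoc, hd2, mul_pow, mul_pow,
            Real.sq_sqrt hA0]
  have h2 : ENNReal.ofReal (‖w - averageCLM Ω d ν w‖ ^ 2) ≤
      ENNReal.ofReal ((√A * d ^ s * ‖u‖) ^ 2) := by
    refine le_trans (le_of_eq ?_) h1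
    rw [ENNReal.ofReal_pow (norm_nonneg _), ofReal_norm, Lp.enorm_def,
      eLpNorm_eq_lintegral_rpow_enorm_toReal two_ne_zero ENNReal.ofNat_ne_top,
      ← ENNReal.rpow_natCast, ← ENNReal.rpow_mul]
    simp
  rw [ENNReal.ofReal_le_ofReal_iff (by positivity)] at h2
  exact (pow_le_pow_iff_left₀ (norm_nonneg _) (by positivity) two_ne_zero).1 h2

/-- The embedding `X₀ → L²(Ω)` is compact. -/
theorem isCompactOperator_toLp_two (h : Setting n s Ω K) :
    IsCompactOperator (X0.toLp h 2 h.two_le_critExp) := by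
  have := h.isFiniteMeasure_restrict
  have hs := h.s_pos
  obtain ⟨C, hC, H⟩ := exists_norm_toLp_sub_average_le h
  choose ν hν using fun m : ℕ =>
    exists_simpleFunc_dist_lt (n := n) h.isBounded (d := 1 / ((m : ℝ) + 1)) (by positivity)
  refine isCompactOperator_of_tendsto (l := atTop) (F := fun m : ℕ =>
    (averageCLM Ω (1 / ((m : ℝ) + 1)) (ν m)).comp (X0.toLp h 2 h.two_le_critExp)) ?_
    (Eventually.of_forall fun m => (isCompactOperator_averageCLM Ω _ (ν m)).comp_clm _)
  rw [tendsto_iff_norm_sub_tendsto_zero]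
  have hlim : Tendsto (fun m : ℕ => C * (1 / ((m : ℝ) + 1)) ^ s) atTop (𝓝 0) := by
    have h1 : Tendsto (fun m : ℕ => (1 / ((m : ℝ) + 1)) ^ s) atTop (𝓝 (0 ^ s)) :=
      tendsto_one_div_add_atTop_nhds_zero_nat.rpow_const (Or.inr hs.le)
    rw [Real.zero_rpow hs.ne'] at h1
    simpa using h1.const_mul C
  refine squeeze_zero (fun m => norm_nonneg _) (fun m => ?_) hlim
  refine ContinuousLinearMap.opNorm_le_bound _ (by positivity) fun u => ?_
  rw [_root_.sub_apply, ← norm_neg, neg_sub]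
  exact H _ (by positivity) (ν m) (hν m) u

/-- Interpolation between `L²` and `L^r`. -/
theorem lintegral_rpow_interpolation {α : Type*} [MeasurableSpace α] (μ : Measure α)
    {g : α → ℝ≥0∞} (hg : AEMeasurable g μ) {q r : ℝ} (h2q : 2 ≤ q) (hqr : q ≤ r) (h2r : 2 < r) :
    ∫⁻ x, g x ^ q ∂μ ≤ (∫⁻ x, g x ^ (2 : ℝ) ∂μ) ^ ((r - q) / (r - 2)) *
      (∫⁻ x, g x ^ r ∂μ) ^ ((q - 2) / (r - 2)) := by
  have h1 := ENNReal.lintegral_mul_norm_pow_le (μ := μ) (f := fun x => g x ^ (2 : ℝ))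
    (g := fun x => g x ^ r) (by fun_prop) (by fun_prop) (p := (r - q) / (r - 2))
    (q := (q - 2) / (r - 2)) (div_nonneg (by linarith) (by linarith))
    (div_nonneg (by linarith) (by linarith)) (by
      have : r - 2 ≠ 0 := by linarith
      field_simp; ring)
  refine le_trans (le_of_eq (lintegral_congr fun x => ?_)) h1
  rw [← ENNReal.rpow_mul, ← ENNReal.rpow_mul, ← ENNReal.rpow_add_of_nonneg]
  · congr 1
    have : r - 2 ≠ 0 := by linarith
    field_simp
    ring
  · exact mul_nonneg zero_le_two (div_nonneg (by linarith) (by linarith))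
  · exact mul_nonneg (by linarith) (div_nonneg (by linarith) (by linarith))

/-- For subcritical `q`, the `L^q(Ω)` norm on `X₀` is controlled by interpolation between the
`L²(Ω)` norm and the norm of `X₀`. -/
theorem exists_norm_toLp_le_interpolation (h : Setting n s Ω K) {q : ℝ} (h2q : 2 < q)
    (hq : q < 2 * n / (n - 2 * s)) [Fact (1 ≤ ENNReal.ofReal q)]
    (hqc : ENNReal.ofReal q ≤ critExp n s) :
    ∃ C a b : ℝ, 0 ≤ C ∧ 0 < a ∧ 0 ≤ b ∧ ∀ u : X0 h,
      ‖X0.toLp h (ENNReal.ofReal q) hqc u‖ ≤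
        C * ‖X0.toLp h 2 h.two_le_critExp u‖ ^ a * ‖u‖ ^ b := by
  set r : ℝ := 2 * n / (n - 2 * s) with hr
  have h2r := h.two_lt_crit
  rw [← hr] at h2r
  obtain ⟨C, hC, H⟩ := exists_eLpNorm_le h (p := critExp n s) le_rfl
  set α := (r - q) / (r - 2) with hα
  set β := (q - 2) / (r - 2) with hβ
  have hα0 : 0 < α := div_pos (by linarith) (by linarith)
  have hβ0 : 0 ≤ β := div_nonneg (by linarith) (by linarith)
  refine ⟨C ^ (r * β / q), 2 * α / q, r * β / q, by positivity, by positivity,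
    by positivity, fun u => ?_⟩
  have h1 := lintegral_rpow_interpolation (volume.restrict Ω) (g := fun x => ‖u x‖ₑ)
    u.measurable.enorm.aemeasurable h2q.le hq.le h2r
  have key : ∀ {p : ℝ}, 0 < p → ∫⁻ x, ‖u x‖ₑ ^ p ∂(volume.restrict Ω) =
      eLpNorm u (ENNReal.ofReal p) (volume.restrict Ω) ^ p := fun {p} hp => by
    rw [eLpNorm_eq_lintegral_rpow_enorm_toReal (by simpa using hp) ENNReal.ofReal_ne_top,
      ENNReal.toReal_ofReal hp.le, ← ENNReal.rpow_mul, one_div, inv_mul_cancel₀ hp.ne',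
      ENNReal.rpow_one]
  have hnorm : ∀ (p : ℝ≥0∞) [Fact (1 ≤ p)] (hp : p ≤ critExp n s),
      eLpNorm u p (volume.restrict Ω) = ENNReal.ofReal ‖X0.toLp h p hp u‖ := fun p _ hp => by
    rw [ofReal_norm, Lp.enorm_def]
    exact (eLpNorm_congr_ae (X0.coeFn_toLp hp u)).symm
  rw [key (by linarith), key zero_lt_two, key (by linarith), hnorm _ hqc, ENNReal.ofReal_ofNat,
    hnorm 2 h.two_le_critExp] at h1
  have h3 : ENNReal.ofReal ‖X0.toLp h (ENNReal.ofReal q) hqc u‖ ^ q ≤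
      (ENNReal.ofReal ‖X0.toLp h 2 h.two_le_critExp u‖ ^ (2 : ℝ)) ^ α *
        (ENNReal.ofReal (C * ‖u‖) ^ r) ^ β := by
    refine h1.trans ?_
    gcongr
    exact H u
  rw [ENNReal.ofReal_rpow_of_nonneg (by positivity) (by linarith),
    ENNReal.ofReal_rpow_of_nonneg (by positivity) (by linarith),
    ENNReal.ofReal_rpow_of_nonneg (by positivity) (by linarith),
    ENNReal.ofReal_rpow_of_nonneg (by positivity) (by linarith),
    ENNReal.ofReal_rpow_of_nonneg (by positivity) (by linarith),
    ← ENNReal.ofReal_mul (by positivity), ENNReal.ofReal_le_ofReal_iff (by positivity)] at h3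
  have hq0 : 0 < q := by linarith
  refine (Real.rpow_le_rpow_iff (norm_nonneg _) (by positivity) hq0).1 (h3.trans (le_of_eq ?_))
  rw [Real.mul_rpow (by positivity) (by positivity), Real.mul_rpow (by positivity) (by positivity),
    Real.mul_rpow (by positivity) (by positivity), Real.mul_rpow (by positivity) (by positivity)]
  simp only [← Real.rpow_mul (norm_nonneg _), ← Real.rpow_mul hC]
  have e1 : r * β / q * q = r * β := by field_simp
  have e2 : 2 * α / q * q = 2 * α := by field_simp
  rw [e1, e2]
  ring

/-- The compact embedding `X₀ → L^q(Ω)` for subcritical `q`, in terms of sequences. -/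
theorem exists_subseq_cauchySeq_toLp (h : Setting n s Ω K) {q : ℝ} (h2q : 2 < q)
    (hq : q < 2 * n / (n - 2 * s)) [Fact (1 ≤ ENNReal.ofReal q)]
    (hqc : ENNReal.ofReal q ≤ critExp n s) (u : ℕ → X0 h) {R : ℝ} (hu : ∀ j, ‖u j‖ ≤ R) :
    ∃ k : ℕ → ℕ, StrictMono k ∧
      CauchySeq (fun j => X0.toLp h 2 h.two_le_critExp (u (k j))) ∧
      CauchySeq (fun j => X0.toLp h (ENNReal.ofReal q) hqc (u (k j))) := by
  obtain ⟨S, hS, hSu⟩ := (isCompactOperator_toLp_two h).image_closedBall_subset_compact R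
  obtain ⟨w, -, k, hk, hw⟩ := hS.tendsto_subseq (x := fun j => X0.toLp h 2 h.two_le_critExp (u j))
    fun j => hSu ⟨u j, by simpa using hu j, rfl⟩
  have hc2 := hw.cauchySeq
  refine ⟨k, hk, hc2, ?_⟩
  obtain ⟨C, a, b, hC, ha, hb, H⟩ := exists_norm_toLp_le_interpolation h h2q hq hqc
  have hR : 0 ≤ R := (norm_nonneg _).trans (hu 0)
  rw [Metric.cauchySeq_iff] at hc2 ⊢
  have hlim : Tendsto (fun t : ℝ => C * t ^ a * (2 * R) ^ b) (𝓝 0) (𝓝 0) := by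
    have h1 : ContinuousAt (fun t : ℝ => C * t ^ a * (2 * R) ^ b) 0 :=
      ((Real.continuousAt_rpow_const _ _ (Or.inr ha.le)).const_mul _).mul_const _
    simpa [ContinuousAt, Real.zero_rpow ha.ne'] using h1
  intro ε hε
  obtain ⟨δ, hδ, hδε⟩ := Metric.eventually_nhds_iff.1 (hlim.eventually (gt_mem_nhds hε))
  obtain ⟨N, hN⟩ := hc2 δ hδ
  refine ⟨N, fun i hi j hj => ?_⟩
  have h1 := hN i hi j hj
  simp only [Function.comp, dist_eq_norm, ← map_sub] at h1 ⊢
  -- Differences stay bounded by 2R in X₀, so interpolation converts the Cauchy property in L² into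
  -- one in L^q.
  have h2 := H (u (k i) - u (k j))
  have h3 : ‖u (k i) - u (k j)‖ ≤ 2 * R := by
    have := norm_sub_le (u (k i)) (u (k j))
    linarith [hu (k i), hu (k j)]
  refine h2.trans_lt (lt_of_le_of_lt ?_ (hδε (y := ‖X0.toLp h 2 h.two_le_critExp
    (u (k i) - u (k j))‖) (by simpa using h1)))
  gcongr

/-! ### Completeness of X₀. -/

/-- The isometric embedding `u ↦ (u(x) - u(y)) √K(x - y)` of `X₀` into `L²(ℝⁿ × ℝⁿ)`. -/
def X0.incrL (h : Setting n s Ω K) : X0 h →ₗᵢ[ℝ] Lp ℝ 2 (volume : Measure (E n × E n)) where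
  toFun u := u.incr_memLp.toLp (incr K u)
  map_add' u v := by
    rw [← MemLp.toLp_add]
    refine MemLp.toLp_congr _ _ ((incr_congr (X0.coe_add u v)).trans (ae_of_all _ fun p => ?_))
    simp only [incr, Pi.add_apply]
    ring
  map_smul' c u := by
    rw [RingHom.id_apply, ← MemLp.toLp_const_smul]
    refine MemLp.toLp_congr _ _ ((incr_congr (X0.coe_smul c u)).trans (ae_of_all _ fun p => ?_))
    simp only [incr, Pi.smul_apply, smul_eq_mul]
    ring
  norm_map' u := by
    refine (pow_left_inj₀ (norm_nonneg _) (norm_nonneg _) two_ne_zero).1 ?_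
    rw [← real_inner_self_eq_norm_sq, L2.inner_def, X0.norm_sq]
    refine integral_congr_ae ?_
    filter_upwards [u.incr_memLp.coeFn_toLp] with p hp
    simp only [LinearMap.coe_mk, AddHom.coe_mk, hp]
    rw [sq_abs, sq, integrand_eq h, RCLike.inner_apply, conj_trivial]

theorem X0.coeFn_incrL (u : X0 h) : X0.incrL h u =ᵐ[volume] incr K u :=
  MemLp.coeFn_toLp u.incr_memLp

/-- A Cauchy sequence converges in L²(Ω) to some w, and its weighted increments converge in L²(ℝⁿ ×
ℝⁿ) to some W. Almost everywhere convergence along a common subsequence shows that W consists of the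
increments of w extended by zero, so this extension lies in X₀ and is the limit. -/
instance : CompleteSpace (X0 h) := by
  refine Metric.complete_of_cauchySeq_tendsto fun u hu => ?_
  have hΩ := h.isOpen.measurableSet
  have h1 : CauchySeq fun j => X0.toLp h 2 h.two_le_critExp (u j) :=
    hu.map (X0.toLp h 2 h.two_le_critExp).uniformContinuous
  have h2 : CauchySeq fun j => X0.incrL h (u j) := hu.map (X0.incrL h).isometry.uniformContinuous
  obtain ⟨w, hw⟩ := cauchySeq_tendsto_of_complete h1
  obtain ⟨W, hW⟩ := cauchySeq_tendsto_of_complete h2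
  obtain ⟨k, hk, hkw⟩ := (tendstoInMeasure_of_tendsto_Lp hw).exists_seq_tendsto_ae
  obtain ⟨l, hl, hlW⟩ :=
    (tendstoInMeasure_of_tendsto_Lp (hW.comp hk.tendsto_atTop)).exists_seq_tendsto_ae
  have hgm : MemLp (Ω.indicator w) 2 volume := (memLp_indicator_iff_restrict hΩ).2 (Lp.memLp w)
  have hu1 : ∀ᵐ x ∂(volume.restrict Ω), ∀ j, X0.toLp h 2 h.two_le_critExp (u j) x = u j x :=
    ae_all_iff.2 fun j => X0.coeFn_toLp h.two_le_critExp (u j)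
  have hu2 : ∀ᵐ x, ∀ j, x ∉ Ω → u j x = 0 := ae_all_iff.2 fun j => (u j).memX0.zero_outside
  have hconv : ∀ᵐ x, Tendsto (fun j => u (k (l j)) x) atTop (𝓝 (Ω.indicator w x)) := by
    filter_upwards [(ae_restrict_iff' hΩ).1 hkw, (ae_restrict_iff' hΩ).1 hu1, hu2] with x a b c
    by_cases hx : x ∈ Ω
    · have := (a hx).comp hl.tendsto_atTop
      simp only [b hx] at this
      rw [Set.indicator_of_mem hx]
      exact this
    · simp only [c _ hx, Set.indicator_of_notMem hx]
      exact tendsto_const_nhds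
  have hincr : incr K (Ω.indicator w) =ᵐ[volume] W := by
    have a1 := (Measure.quasiMeasurePreserving_fst (μ := (volume : Measure (E n)))
      (ν := (volume : Measure (E n)))).ae hconv
    have a2 := (Measure.quasiMeasurePreserving_snd (μ := (volume : Measure (E n)))
      (ν := (volume : Measure (E n)))).ae hconv
    have a3 : ∀ᵐ p : E n × E n, ∀ j, X0.incrL h (u j) p = incr K (u j) p :=
      ae_all_iff.2 fun j => X0.coeFn_incrL (u j)
    rw [← Measure.volume_eq_prod] at a1 a2
    filter_upwards [a1, a2, a3, hlW] with p p1 p2 p3 p4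
    simp only [Function.comp, p3] at p4
    exact tendsto_nhds_unique ((p1.sub p2).mul_const _) p4
  have hmem : MemX0 Ω K (Ω.indicator w) :=
    { measurable := hgm.1.aemeasurable
      memLp := hgm.restrict _
      incr_memLp := ((memLp_congr_ae hincr).2 (Lp.memLp W)).restrict _
      zero_outside := ae_of_all _ fun x hx => Set.indicator_of_notMem hx _ }
  refine ⟨X0.mk h _ hmem, ?_⟩
  have hWU : X0.incrL h (X0.mk h _ hmem) = W :=
    Lp.ext ((X0.coeFn_incrL _).trans ((incr_congr (X0.coe_mk _ hmem)).trans hincr))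
  rw [← hWU] at hW
  exact ((X0.incrL h).isometry.isEmbedding.tendsto_nhds_iff).2 hW

end

/-! ### Superposition operators and differentiability of w ↦ ∫ F(x, w) on L^q. -/

section

variable {n : ℕ} {μ : Measure (E n)} {f : E n → ℝ → ℝ} {a₁ a₂ q : ℝ}

/-- A jointly continuous nonlinearity with `|f(x,t)| ≤ a₁ + a₂ |t|^{q-1}` for `μ`-a.e. `x`. -/
structure PowerGrowth (μ : Measure (E n)) (f : E n → ℝ → ℝ) (a₁ a₂ q : ℝ) : Prop where
  continuous : Continuous (Function.uncurry f)
  a₁_nonneg : 0 ≤ a₁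
  a₂_nonneg : 0 ≤ a₂
  one_lt : 1 < q
  bound : ∀ᵐ x ∂μ, ∀ t : ℝ, |f x t| ≤ a₁ + a₂ * |t| ^ (q - 1)

theorem continuous_primitive (hf : Continuous (Function.uncurry f)) :
    Continuous (Function.uncurry (primitive f)) := by
  have : Continuous (Function.uncurry fun (p : E n × ℝ) τ => f p.1 τ) :=
    hf.comp ((continuous_fst.comp continuous_fst).prodMk continuous_snd)
  exact intervalIntegral.continuous_parametric_intervalIntegral_of_continuous this continuous_snd

theorem primitive_sub (hf : Continuous (Function.uncurry f)) (x : E n) (a b : ℝ) :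
    primitive f x b - primitive f x a = ∫ τ in a..b, f x τ := by
  have hc : Continuous (f x) := hf.comp (Continuous.prodMk_right x)
  exact intervalIntegral.integral_interval_sub_left (hc.intervalIntegrable _ _)
    (hc.intervalIntegrable _ _)

theorem hasDerivAt_primitive (hf : Continuous (Function.uncurry f)) (x : E n) (t : ℝ) :
    HasDerivAt (primitive f x) (f x t) t := by
  have hc : Continuous (f x) := hf.comp (Continuous.prodMk_right x)
  exact intervalIntegral.integral_hasDerivAt_right (hc.intervalIntegrable _ _)
    (hc.stronglyMeasurableAtFilter _ _) hc.continuousAt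

theorem abs_primitive_sub_le (hf : Continuous (Function.uncurry f)) {x : E n} (hq : 1 < q)
    (ha₂ : 0 ≤ a₂) (hx : ∀ t : ℝ, |f x t| ≤ a₁ + a₂ * |t| ^ (q - 1)) {a b S : ℝ}
    (ha : |a| ≤ S) (hb : |b| ≤ S) :
    |primitive f x b - primitive f x a| ≤ (a₁ + a₂ * S ^ (q - 1)) * |b - a| := by
  rw [primitive_sub hf, ← Real.norm_eq_abs]
  refine intervalIntegral.norm_integral_le_of_norm_le_const fun τ hτ => ?_
  have h1 : |τ| ≤ S := by
    rw [abs_le] at *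
    rcases Set.mem_uIoc.1 hτ with h | h <;> constructor <;> linarith
  refine (hx τ).trans ?_
  have := Real.rpow_le_rpow (abs_nonneg τ) h1 (sub_nonneg.2 hq.le)
  nlinarith

/-- The conjugate exponent `q/(q-1)`, as an extended nonnegative real. -/
def dualExp (q : ℝ) : ℝ≥0∞ := ENNReal.ofReal q.conjExponent

theorem dualExp_holderConjugate (hq : 1 < q) :
    ENNReal.HolderConjugate (dualExp q) (ENNReal.ofReal q) :=
  (Real.HolderConjugate.conjExponent hq).symm.ennrealOfReal

theorem ofReal_div_sub_one (hq : 1 < q) :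
    ENNReal.ofReal q / ENNReal.ofReal (q - 1) = dualExp q := by
  rw [dualExp, Real.conjExponent, ENNReal.ofReal_div_of_pos (by linarith)]

theorem dualExp_mul (hq : 1 < q) : dualExp q * ENNReal.ofReal (q - 1) = ENNReal.ofReal q := by
  rw [← ofReal_div_sub_one hq, ENNReal.div_mul_cancel] <;> simp [hq]

namespace PowerGrowth

theorem one_le_ofReal (hf : PowerGrowth μ f a₁ a₂ q) : 1 ≤ ENNReal.ofReal q := by
  rw [← ENNReal.ofReal_one]; exact ENNReal.ofReal_le_ofReal hf.one_lt.le

theorem aestronglyMeasurable_comp (hf : PowerGrowth μ f a₁ a₂ q) {w : E n → ℝ} (hw : AEStronglyMeasurable w μ) :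
    AEStronglyMeasurable (fun x => f x (w x)) μ :=
  hf.continuous.comp_aestronglyMeasurable
    (continuous_id.aestronglyMeasurable.prodMk hw)

theorem aestronglyMeasurable_primitive_comp (hf : PowerGrowth μ f a₁ a₂ q) {w : E n → ℝ} (hw : AEStronglyMeasurable w μ) :
    AEStronglyMeasurable (fun x => primitive f x (w x)) μ :=
  (continuous_primitive hf.continuous).comp_aestronglyMeasurable
    (continuous_id.aestronglyMeasurable.prodMk hw)

/-- Since q'(q − 1) = q, the L^(q') norm of |w|^(q−1) is ‖w‖_q^(q−1). The quantitative form serves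
both for membership in L^(q') and for bounding the derivative on balls. -/
theorem eLpNorm_comp_le (hf : PowerGrowth μ f a₁ a₂ q) {w : E n → ℝ} (hw : AEStronglyMeasurable w μ) :
    eLpNorm (fun x => f x (w x)) (dualExp q) μ ≤ eLpNorm (fun _ : E n => a₁) (dualExp q) μ +
      ENNReal.ofReal a₂ * eLpNorm w (ENNReal.ofReal q) μ ^ (q - 1) := by
  have hd := dualExp_holderConjugate hf.one_lt
  have h1 : eLpNorm (fun x => f x (w x)) (dualExp q) μ ≤
      eLpNorm ((fun _ : E n => a₁) + a₂ • fun x => ‖w x‖ ^ (q - 1)) (dualExp q) μ := by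
    refine eLpNorm_mono_ae_real ?_
    filter_upwards [hf.bound] with x hx
    exact hx (w x)
  have hm : AEStronglyMeasurable (a₂ • fun x => ‖w x‖ ^ (q - 1)) μ :=
    ((hw.norm.aemeasurable.pow_const (q - 1)).aestronglyMeasurable).const_smul a₂
  refine h1.trans ((eLpNorm_add_le aestronglyMeasurable_const hm hd.one_le).trans ?_)
  rw [eLpNorm_const_smul, eLpNorm_norm_rpow _ (sub_pos.2 hf.one_lt), dualExp_mul hf.one_lt,
    Real.enorm_of_nonneg hf.a₂_nonneg]

variable [IsFiniteMeasure μ]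

theorem memLp_comp (hf : PowerGrowth μ f a₁ a₂ q) {w : E n → ℝ} (hw : MemLp w (ENNReal.ofReal q) μ) :
    MemLp (fun x => f x (w x)) (dualExp q) μ := by
  refine ⟨hf.aestronglyMeasurable_comp hw.1, (hf.eLpNorm_comp_le hw.1).trans_lt ?_⟩
  exact ENNReal.add_lt_top.2 ⟨(memLp_const a₁).2, ENNReal.mul_lt_top ENNReal.ofReal_lt_top
    (ENNReal.rpow_lt_top_of_nonneg (sub_nonneg.2 hf.one_lt.le) hw.2.ne)⟩

theorem integrable_primitive_comp (hf : PowerGrowth μ f a₁ a₂ q) {w : E n → ℝ} (hw : MemLp w (ENNReal.ofReal q) μ) :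
    Integrable (fun x => primitive f x (w x)) μ := by
  have h1 : Integrable (fun x => a₁ * ‖w x‖ + a₂ * ‖w x‖ ^ q) μ := by
    refine ((hw.integrable hf.one_le_ofReal).norm.const_mul a₁).add (Integrable.const_mul ?_ a₂)
    have := hw.integrable_norm_rpow (by simpa using zero_lt_one.trans hf.one_lt) ENNReal.ofReal_ne_top
    rwa [ENNReal.toReal_ofReal (by linarith [hf.one_lt])] at this
  refine h1.mono' (hf.aestronglyMeasurable_primitive_comp hw.1) ?_
  filter_upwards [hf.bound] with x hx
  have h2 := abs_primitive_sub_le hf.continuous hf.one_lt hf.a₂_nonneg hx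
    (a := 0) (b := w x) (S := |w x|) (by simp) le_rfl
  have h3 : primitive f x 0 = 0 := by simp [primitive]
  rw [h3, sub_zero, sub_zero] at h2
  refine h2.trans (le_of_eq ?_)
  rcases eq_or_ne (w x) 0 with h0 | h0
  · simp [h0, Real.zero_rpow (zero_lt_one.trans hf.one_lt).ne']
  · rw [add_mul, mul_assoc, ← Real.rpow_add_one (abs_pos.2 h0).ne', sub_add_cancel]
    rfl

/-- The superposition operator `w ↦ f(·, w)` from `L^q` to its dual exponent. -/
def nemytskii (hf : PowerGrowth μ f a₁ a₂ q) (w : Lp ℝ (ENNReal.ofReal q) μ) : Lp ℝ (dualExp q) μ :=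
  (hf.memLp_comp (Lp.memLp w)).toLp _

end PowerGrowth

/-- Dominated convergence when the domination holds up to a sequence that is small in `L¹`. -/
theorem tendsto_lintegral_zero_of_le_add {α : Type*} [MeasurableSpace α] {ν : Measure α}
    {g e : ℕ → α → ℝ≥0∞} {G : α → ℝ≥0∞} (hg : ∀ j, AEMeasurable (g j) ν)
    (he : ∀ j, AEMeasurable (e j) ν) (hG : ∫⁻ x, G x ∂ν ≠ ⊤)
    (hle : ∀ j, ∀ᵐ x ∂ν, g j x ≤ G x + e j x)
    (he0 : Tendsto (fun j => ∫⁻ x, e j x ∂ν) atTop (𝓝 0))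
    (hg0 : ∀ᵐ x ∂ν, Tendsto (fun j => g j x) atTop (𝓝 0)) :
    Tendsto (fun j => ∫⁻ x, g j x ∂ν) atTop (𝓝 0) := by
  -- The truncated difference g − e is dominated by G and squeezed between 0 and g; adding e back
  -- costs only its integral.
  have h1 : Tendsto (fun j => ∫⁻ x, (g j x - e j x) ∂ν) atTop (𝓝 0) := by
    have := tendsto_lintegral_of_dominated_convergence' (μ := ν) (f := fun _ => 0)
      (F := fun j x => g j x - e j x) G (fun j => (hg j).sub (he j))
      (fun j => by
        filter_upwards [hle j] with x hx
        exact tsub_le_iff_right.2 hx) hG (by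
        filter_upwards [hg0] with x hx
        exact tendsto_of_tendsto_of_tendsto_of_le_of_le tendsto_const_nhds hx
          (fun _ => zero_le) (fun _ => tsub_le_self))
    simpa using this
  have h2 := h1.add he0
  rw [add_zero] at h2
  refine tendsto_of_tendsto_of_tendsto_of_le_of_le tendsto_const_nhds h2 (fun _ => zero_le)
    fun j => ?_
  rw [← lintegral_add_right' _ (he j)]
  exact lintegral_mono fun x => le_tsub_add

/-- The normalised first order remainder of the primitive. -/
def remainder (f : E n → ℝ → ℝ) (x : E n) (a b : ℝ) : ℝ :=
  ‖b - a‖⁻¹ * ‖primitive f x b - primitive f x a - (b - a) • f x a‖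

theorem remainder_mul (f : E n → ℝ → ℝ) (x : E n) (a b : ℝ) :
    remainder f x a b * ‖b - a‖ =
      ‖primitive f x b - primitive f x a - (b - a) • f x a‖ := by
  rcases eq_or_ne b a with rfl | h
  · simp
  · rw [remainder, mul_comm, mul_inv_cancel_left₀ (norm_ne_zero_iff.2 (sub_ne_zero.2 h))]

theorem remainder_nonneg (f : E n → ℝ → ℝ) (x : E n) (a b : ℝ) : 0 ≤ remainder f x a b := by
  unfold remainder; positivity

theorem tendsto_remainder (hf : Continuous (Function.uncurry f)) (x : E n) (a : ℝ) :
    Tendsto (fun b => remainder f x a b) (𝓝 a) (𝓝 0) :=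
  hasDerivAt_iff_tendsto.1 (hasDerivAt_primitive hf x a)

/-- With S = |a| + |b − a|, the growth bound on [−S, S] controls both the difference quotient and
f(x, a). Raising to the conjugate exponent turns (1 + S)^(q−1) into (1 + S)^q, which splits into a
term in a alone and a multiple of |b − a|^q: a fixed integrable majorant plus an error small in L¹.
-/
theorem remainder_le (hf : Continuous (Function.uncurry f)) {x : E n} (hq : 1 < q)
    (ha₁ : 0 ≤ a₁) (ha₂ : 0 ≤ a₂) (hx : ∀ t : ℝ, |f x t| ≤ a₁ + a₂ * |t| ^ (q - 1)) (a b : ℝ) :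
    remainder f x a b ^ q.conjExponent ≤
      (2 * (a₁ + a₂)) ^ q.conjExponent * 2 ^ q * (1 + |a|) ^ q +
        (2 * (a₁ + a₂)) ^ q.conjExponent * 2 ^ q * |b - a| ^ q := by
  set S := |a| + |b - a| with hS
  have hb : |b| ≤ S := by
    have := abs_add_le a (b - a)
    rwa [add_sub_cancel] at this
  have ha : |a| ≤ S := by have := abs_nonneg (b - a); linarith
  have hS0 : 0 ≤ S := (abs_nonneg a).trans ha
  have hq' : 0 < q.conjExponent := (Real.HolderConjugate.conjExponent hq).symm.pos
  set M := a₁ + a₂ * S ^ (q - 1) with hM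
  have hM0 : 0 ≤ M := by positivity
  have h1 := abs_primitive_sub_le hf hq ha₂ hx ha hb
  have h2 : |f x a| ≤ M := (hx a).trans (by
    have := Real.rpow_le_rpow (abs_nonneg a) ha (sub_nonneg.2 hq.le)
    nlinarith)
  have h3 : remainder f x a b ≤ 2 * M := by
    rcases eq_or_ne b a with rfl | hab
    · simp [remainder]; positivity
    rw [remainder, inv_mul_le_iff₀ (norm_pos_iff.2 (sub_ne_zero.2 hab))]
    refine (norm_sub_le _ _).trans ?_
    rw [norm_smul]
    simp only [Real.norm_eq_abs]
    nlinarith [abs_nonneg (b - a)]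
  have h4 : 2 * M ≤ 2 * (a₁ + a₂) * (1 + S) ^ (q - 1) := by
    have e1 : 1 ≤ (1 + S) ^ (q - 1) := Real.one_le_rpow (by linarith) (by linarith)
    have e2 : S ^ (q - 1) ≤ (1 + S) ^ (q - 1) :=
      Real.rpow_le_rpow hS0 (by linarith) (by linarith)
    rw [hM]
    nlinarith [mul_le_mul_of_nonneg_left e1 ha₁, mul_le_mul_of_nonneg_left e2 ha₂]
  have h5 : (1 + S) ^ q ≤ 2 ^ q * (1 + |a|) ^ q + 2 ^ q * |b - a| ^ q := by
    have e3 : 1 + S ≤ 2 * max (1 + |a|) |b - a| := by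
      have := le_max_left (1 + |a|) |b - a|
      have := le_max_right (1 + |a|) |b - a|
      linarith
    refine (Real.rpow_le_rpow (by linarith) e3 (by linarith)).trans ?_
    rw [Real.mul_rpow zero_le_two (by positivity)]
    rcases le_total (1 + |a|) |b - a| with h | h
    · rw [max_eq_right h]
      have : 0 ≤ (2 : ℝ) ^ q * (1 + |a|) ^ q := by positivity
      linarith
    · rw [max_eq_left h]
      have : 0 ≤ (2 : ℝ) ^ q * |b - a| ^ q := by positivity
      linarith
  calc remainder f x a b ^ q.conjExponent
      ≤ (2 * (a₁ + a₂) * (1 + S) ^ (q - 1)) ^ q.conjExponent :=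
        Real.rpow_le_rpow (remainder_nonneg _ _ _ _) (h3.trans h4) hq'.le
    _ = (2 * (a₁ + a₂)) ^ q.conjExponent * (1 + S) ^ q := by
        rw [Real.mul_rpow (by positivity) (by positivity), ← Real.rpow_mul (by positivity)]
        congr 2
        rw [Real.conjExponent]
        have : q - 1 ≠ 0 := by linarith
        field_simp
    _ ≤ (2 * (a₁ + a₂)) ^ q.conjExponent * (2 ^ q * (1 + |a|) ^ q + 2 ^ q * |b - a| ^ q) := by
        gcongr
    _ = _ := by ring

theorem lintegral_const_mul_one_add_ne_top [IsFiniteMeasure μ] (hq0 : 0 < q) {D : ℝ}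
    {w : E n → ℝ} (hw : MemLp w (ENNReal.ofReal q) μ) :
    ∫⁻ x, ENNReal.ofReal (D * (1 + |w x|) ^ q) ∂μ ≠ ⊤ := by
  have h0 : MemLp (fun _ : E n => (1 : ℝ)) (ENNReal.ofReal q) μ := memLp_const 1
  have h1 := h0.add hw.norm
  have h2 := h1.integrable_norm_rpow (by simpa using hq0) ENNReal.ofReal_ne_top
  rw [ENNReal.toReal_ofReal hq0.le] at h2
  have h3 := (h2.const_mul D).lintegral_lt_top
  refine ne_of_lt (lt_of_eq_of_lt (lintegral_congr fun x => ?_) h3)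
  rw [Pi.add_apply, Real.norm_of_nonneg (add_nonneg zero_le_one (norm_nonneg _)), Real.norm_eq_abs]

theorem lintegral_const_mul_sub_rpow [Fact (1 ≤ ENNReal.ofReal q)] (hq0 : 0 < q) {D : ℝ} (hD : 0 ≤ D)
    (v w : Lp ℝ (ENNReal.ofReal q) μ) :
    ∫⁻ x, ENNReal.ofReal (D * |v x - w x| ^ q) ∂μ = ENNReal.ofReal (D * ‖v - w‖ ^ q) := by
  rw [ENNReal.ofReal_mul hD, ← ENNReal.ofReal_rpow_of_nonneg (norm_nonneg _) hq0.le,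
    ofReal_norm, Lp.enorm_def, eLpNorm_eq_lintegral_rpow_enorm_toReal (by simpa using hq0)
    ENNReal.ofReal_ne_top, ENNReal.toReal_ofReal hq0.le, ← ENNReal.rpow_mul, one_div,
    inv_mul_cancel₀ hq0.ne', ENNReal.rpow_one, ← lintegral_const_mul' _ _ ENNReal.ofReal_ne_top]
  refine lintegral_congr_ae ?_
  filter_upwards [Lp.coeFn_sub v w] with x hx
  rw [hx, Pi.sub_apply, ENNReal.ofReal_mul hD, Real.enorm_eq_ofReal_abs,
    ENNReal.ofReal_rpow_of_nonneg (abs_nonneg _) hq0.le]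

namespace PowerGrowth

theorem aestronglyMeasurable_remainder {v w : E n → ℝ} (hf : PowerGrowth μ f a₁ a₂ q)
    (hv : AEStronglyMeasurable v μ) (hw : AEStronglyMeasurable w μ) :
    AEStronglyMeasurable (fun x => remainder f x (v x) (w x)) μ := by
  have h1 := hf.aestronglyMeasurable_primitive_comp hv
  have h2 := hf.aestronglyMeasurable_primitive_comp hw
  have h3 := hf.aestronglyMeasurable_comp hv
  exact ((hw.sub hv).norm.aemeasurable.inv.aestronglyMeasurable).mul
    (((h2.sub h1).sub ((hw.sub hv).smul h3)).norm)

variable [IsFiniteMeasure μ] [Fact (1 ≤ ENNReal.ofReal q)]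

theorem tendsto_lintegral_remainder (hf : PowerGrowth μ f a₁ a₂ q)
    {w : Lp ℝ (ENNReal.ofReal q) μ} {v : ℕ → Lp ℝ (ENNReal.ofReal q) μ}
    (hv : Tendsto v atTop (𝓝 w)) (hae : ∀ᵐ x ∂μ, Tendsto (fun i => v i x) atTop (𝓝 (w x))) :
    Tendsto (fun i => ∫⁻ x, ENNReal.ofReal (remainder f x (w x) (v i x) ^ q.conjExponent) ∂μ)
      atTop (𝓝 0) := by
  have hq := hf.one_lt
  have hq0 : 0 < q := zero_lt_one.trans hq
  have hq' : 0 < q.conjExponent := (Real.HolderConjugate.conjExponent hq).symm.pos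
  obtain ⟨D, hD0, hD⟩ : ∃ D : ℝ, 0 ≤ D ∧ ∀ᵐ x ∂μ, ∀ a b, remainder f x a b ^ q.conjExponent ≤
      D * (1 + |a|) ^ q + D * |b - a| ^ q := by
    have h1 := hf.a₁_nonneg
    have h2 := hf.a₂_nonneg
    refine ⟨(2 * (a₁ + a₂)) ^ q.conjExponent * 2 ^ q, by positivity, ?_⟩
    filter_upwards [hf.bound] with x hx
    exact remainder_le hf.continuous hq h1 h2 hx
  refine tendsto_lintegral_zero_of_le_add
    (G := fun x => ENNReal.ofReal (D * (1 + |w x|) ^ q))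
    (e := fun i x => ENNReal.ofReal (D * |v i x - w x| ^ q)) (fun i => ?_) (fun i => ?_)
    (lintegral_const_mul_one_add_ne_top hq0 (Lp.memLp w)) (fun i => ?_) ?_ ?_
  · exact ((hf.aestronglyMeasurable_remainder (Lp.aestronglyMeasurable w)
      (Lp.aestronglyMeasurable _)).aemeasurable.pow_const _).ennreal_ofReal
  · exact ((((Lp.aestronglyMeasurable _).sub
      (Lp.aestronglyMeasurable w)).norm.aemeasurable.pow_const q).const_mul D).ennreal_ofReal
  · filter_upwards [hD] with x hx
    rw [← ENNReal.ofReal_add (by positivity) (by positivity)]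
    exact ENNReal.ofReal_le_ofReal (hx _ _)
  · simp only [lintegral_const_mul_sub_rpow hq0 hD0]
    have h2 := (tendsto_iff_norm_sub_tendsto_zero.1 hv).rpow_const (p := q) (Or.inr hq0.le)
    rw [Real.zero_rpow hq0.ne'] at h2
    simpa using ENNReal.tendsto_ofReal (h2.const_mul D)
  · filter_upwards [hae] with x hx
    have h1 := ((tendsto_remainder hf.continuous x (w x)).comp hx).rpow_const
      (p := q.conjExponent) (Or.inr hq'.le)
    rw [Real.zero_rpow hq'.ne'] at h1
    simpa using ENNReal.tendsto_ofReal h1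

/-- Convergence in L^q gives pointwise convergence only along subsequences, which suffices by the
subsequence principle. -/
theorem tendsto_eLpNorm_remainder (hf : PowerGrowth μ f a₁ a₂ q)
    (w : Lp ℝ (ENNReal.ofReal q) μ) :
    Tendsto (fun v : Lp ℝ (ENNReal.ofReal q) μ =>
      eLpNorm (fun x => remainder f x (w x) (v x)) (dualExp q) μ) (𝓝 w) (𝓝 0) := by
  have hq' : 0 < q.conjExponent := (Real.HolderConjugate.conjExponent hf.one_lt).symm.pos
  refine tendsto_of_seq_tendsto fun v hv => tendsto_of_subseq_tendsto fun k hk => ?_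
  obtain ⟨l, hl, hae⟩ := (tendstoInMeasure_of_tendsto_Lp (hv.comp hk)).exists_seq_tendsto_ae
  refine ⟨l, ?_⟩
  have key := hf.tendsto_lintegral_remainder ((hv.comp hk).comp hl.tendsto_atTop) hae
  have h3 := (ENNReal.continuous_rpow_const (y := 1 / q.conjExponent)).tendsto 0 |>.comp key
  rw [ENNReal.zero_rpow_of_pos (one_div_pos.2 hq')] at h3
  refine h3.congr fun i => ?_
  simp only [Function.comp]
  rw [dualExp, eLpNorm_eq_lintegral_rpow_enorm_toReal (by simpa using hq') ENNReal.ofReal_ne_top,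
    ENNReal.toReal_ofReal hq'.le]
  congr 1
  refine lintegral_congr fun x => ?_
  rw [Real.enorm_of_nonneg (remainder_nonneg _ _ _ _),
    ENNReal.ofReal_rpow_of_nonneg (remainder_nonneg _ _ _ _) hq'.le]

/-- The derivative of `w ↦ ∫ F(x, w(x)) dμ` at `w`, that is `φ ↦ ∫ f(x, w(x)) φ(x) dμ`. -/
def derivPotential (hf : PowerGrowth μ f a₁ a₂ q) (w : Lp ℝ (ENNReal.ofReal q) μ) :
    Lp ℝ (ENNReal.ofReal q) μ →L[ℝ] ℝ :=
  haveI := dualExp_holderConjugate hf.one_lt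
  haveI : Fact (1 ≤ dualExp q) := ⟨(dualExp_holderConjugate hf.one_lt).one_le⟩
  (ContinuousLinearMap.mul ℝ ℝ).lpPairing μ (dualExp q) (ENNReal.ofReal q) (hf.nemytskii w)

theorem derivPotential_apply (hf : PowerGrowth μ f a₁ a₂ q)
    (w φ : Lp ℝ (ENNReal.ofReal q) μ) :
    hf.derivPotential w φ = ∫ x, f x (w x) * φ x ∂μ := by
  have := dualExp_holderConjugate hf.one_lt
  have : Fact (1 ≤ dualExp q) := ⟨(dualExp_holderConjugate hf.one_lt).one_le⟩
  rw [derivPotential, ContinuousLinearMap.lpPairing_eq_integral]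
  refine integral_congr_ae ?_
  filter_upwards [(hf.memLp_comp (Lp.memLp w)).coeFn_toLp] with x hx
  rw [nemytskii, hx, ContinuousLinearMap.mul_apply']

/-- Boundedness on balls is all that the compactness argument needs from the derivative; its
continuity is never required. -/
theorem exists_norm_derivPotential_le (hf : PowerGrowth μ f a₁ a₂ q) (R : ℝ) :
    ∃ C : ℝ, ∀ w : Lp ℝ (ENNReal.ofReal q) μ, ‖w‖ ≤ R → ‖hf.derivPotential w‖ ≤ C := by
  have := dualExp_holderConjugate hf.one_lt
  have : Fact (1 ≤ dualExp q) := ⟨(dualExp_holderConjugate hf.one_lt).one_le⟩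
  set c := eLpNorm (fun _ : E n => a₁) (dualExp q) μ +
      ENNReal.ofReal a₂ * ENNReal.ofReal R ^ (q - 1) with hc
  have hctop : c ≠ ⊤ := ENNReal.add_ne_top.2 ⟨(memLp_const a₁).2.ne,
    ENNReal.mul_ne_top ENNReal.ofReal_ne_top
    (ENNReal.rpow_ne_top_of_nonneg (sub_nonneg.2 hf.one_lt.le) ENNReal.ofReal_ne_top)⟩
  refine ⟨‖(ContinuousLinearMap.mul ℝ ℝ).lpPairing μ (dualExp q) (ENNReal.ofReal q)‖ * c.toReal,
    fun w hw => ?_⟩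
  refine (((ContinuousLinearMap.mul ℝ ℝ).lpPairing μ (dualExp q)
    (ENNReal.ofReal q)).le_opNorm (hf.nemytskii w)).trans ?_
  gcongr
  rw [nemytskii, Lp.norm_toLp]
  refine ENNReal.toReal_mono hctop ((hf.eLpNorm_comp_le (Lp.aestronglyMeasurable w)).trans ?_)
  rw [← Lp.enorm_def, ← ofReal_norm, hc]
  have := hf.one_lt
  gcongr

/-- `w ↦ ∫ F(x, w(x)) dμ` is Fréchet differentiable on `L^q`. -/
theorem hasFDerivAt_potential (hf : PowerGrowth μ f a₁ a₂ q) (w : Lp ℝ (ENNReal.ofReal q) μ) :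
    HasFDerivAt (fun v : Lp ℝ (ENNReal.ofReal q) μ => ∫ x, primitive f x (v x) ∂μ)
      (hf.derivPotential w) w := by
  have hconj := dualExp_holderConjugate hf.one_lt
  rw [hasFDerivAt_iff_tendsto]
  have h0 := hf.tendsto_eLpNorm_remainder w
  have h1 := (ENNReal.tendsto_toReal ENNReal.zero_ne_top).comp h0
  refine squeeze_zero' (Eventually.of_forall fun v => by positivity) ?_ h1
  filter_upwards [h0.eventually (gt_mem_nhds ENNReal.zero_lt_top)] with v hv
  have hrem : AEStronglyMeasurable (fun x => remainder f x (w x) (v x)) μ :=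
    hf.aestronglyMeasurable_remainder (Lp.aestronglyMeasurable w) (Lp.aestronglyMeasurable v)
  have hfw := hf.memLp_comp (Lp.memLp w)
  have hint : Integrable (fun x => f x (w x) * (v - w) x) μ := (Lp.memLp (v - w)).integrable_mul hfw |>.congr
    (ae_of_all _ fun x => mul_comm _ _)
  have e1 : (∫ x, primitive f x (v x) ∂μ) - (∫ x, primitive f x (w x) ∂μ) -
      hf.derivPotential w (v - w) =
      ∫ x, (primitive f x (v x) - primitive f x (w x) - f x (w x) * (v - w) x) ∂μ := by
    rw [derivPotential_apply, ← integral_sub, ← integral_sub _ hint]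
    · exact (hf.integrable_primitive_comp (Lp.memLp v)).sub (hf.integrable_primitive_comp (Lp.memLp w))
    · exact hf.integrable_primitive_comp (Lp.memLp v)
    · exact hf.integrable_primitive_comp (Lp.memLp w)
  -- The integrand has absolute value remainder times |v − w|, to which Hölder's inequality with
  -- exponents q' and q applies.
  have e2 : ‖∫ x, (primitive f x (v x) - primitive f x (w x) - f x (w x) * (v - w) x) ∂μ‖ₑ ≤
      eLpNorm (fun x => remainder f x (w x) (v x)) (dualExp q) μ * ‖v - w‖ₑ := by
    refine (enorm_integral_le_lintegral_enorm _).trans ?_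
    rw [Lp.enorm_def]
    refine le_trans ?_ (eLpNorm_smul_le_mul_eLpNorm (r := 1) (Lp.aestronglyMeasurable (v - w)) hrem)
    rw [eLpNorm_one_eq_lintegral_enorm]
    refine lintegral_mono_ae ?_
    filter_upwards [Lp.coeFn_sub v w] with x hx
    have := remainder_mul f x (w x) (v x)
    rw [Pi.smul_apply', hx, Pi.sub_apply, enorm_smul, mul_comm (f x (w x))]
    rw [← ofReal_norm, ← ofReal_norm, ← ofReal_norm, Real.norm_of_nonneg (remainder_nonneg _ _ _ _),
      ← ENNReal.ofReal_mul (remainder_nonneg _ _ _ _), this]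
    rfl
  rw [e1]
  have e3 := ENNReal.toReal_mono (ENNReal.mul_ne_top hv.ne enorm_ne_top) e2
  rw [ENNReal.toReal_mul, toReal_enorm, toReal_enorm] at e3
  rcases eq_or_ne v w with rfl | hvw
  · simp
  · rw [inv_mul_le_iff₀ (norm_pos_iff.2 (sub_ne_zero.2 hvw)), mul_comm]
    exact e3

end PowerGrowth

end

/-! ### The Cerami condition for abstract functionals ½‖u‖² − (λ/2)‖Pu‖² − Φ(Qu). -/

section

section Abstract

variable {V H L : Type*} [NormedAddCommGroup V] [InnerProductSpace ℝ V]
  [NormedAddCommGroup H] [InnerProductSpace ℝ H] [NormedAddCommGroup L] [NormedSpace ℝ L]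

/-- The real `sSup` is 0 on the empty set, which is the right value when V is trivial, and on
unbounded sets, which is why the bound by ‖T‖ has to be supplied. -/
theorem norm_le_sSup_unit (T : V →L[ℝ] ℝ) :
    ‖T‖ ≤ sSup {r : ℝ | ∃ φ : V, ‖φ‖ = 1 ∧ r = |T φ|} := by
  refine T.opNorm_le_of_unit_norm (Real.sSup_nonneg ?_) fun φ hφ => ?_
  · rintro r ⟨φ, -, rfl⟩
    exact abs_nonneg _
  · refine le_csSup ⟨‖T‖, ?_⟩ ⟨φ, hφ, rfl⟩
    rintro r ⟨ψ, hψ, rfl⟩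
    simpa [hψ] using T.le_opNorm ψ

/-- The functional `½‖u‖² - (λ/2)‖Pu‖² - Φ(Qu)`. -/
def potentialEnergy (lam : ℝ) (P : V →L[ℝ] H) (Q : V →L[ℝ] L) (Φ : L → ℝ) (u : V) : ℝ :=
  1 / 2 * ‖u‖ ^ 2 - lam / 2 * ‖P u‖ ^ 2 - Φ (Q u)

variable {lam : ℝ} {P : V →L[ℝ] H} {Q : V →L[ℝ] L} {Φ : L → ℝ} {DΦ : L → L →L[ℝ] ℝ}

theorem hasFDerivAt_potentialEnergy (hΦ : ∀ w, HasFDerivAt Φ (DΦ w) w) (u : V) :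
    HasFDerivAt (potentialEnergy lam P Q Φ)
      (innerSL ℝ u - lam • (innerSL ℝ (P u)).comp P - (DΦ (Q u)).comp Q) u := by
  have h1 := ((hasStrictFDerivAt_norm_sq u).hasFDerivAt).const_mul (1 / 2 : ℝ)
  have h2 := ((hasStrictFDerivAt_norm_sq (P u)).hasFDerivAt.comp u P.hasFDerivAt).const_mul
    (lam / 2)
  have h3 := (hΦ (Q u)).comp u Q.hasFDerivAt
  refine ((h1.sub h2).sub h3).congr_fderiv ?_
  ext φ
  simp
  ring

theorem fderiv_potentialEnergy_apply (hΦ : ∀ w, HasFDerivAt Φ (DΦ w) w) (u φ : V) :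
    fderiv ℝ (potentialEnergy lam P Q Φ) u φ =
      inner ℝ u φ - lam * inner ℝ (P u) (P φ) - DΦ (Q u) (Q φ) := by
  rw [(hasFDerivAt_potentialEnergy hΦ u).fderiv]
  simp

/-- Along a sequence with bounded energy and norms tending to infinity, the normalised sequence
vanishes in `H` when `Φ` grows superquadratically. -/
theorem tendsto_map_normalized_zero
    (hsuper : ∀ M : ℝ, ∃ C : ℝ, ∀ u, M * ‖P u‖ ^ 2 - C ≤ Φ (Q u)) {w : ℕ → V} {c : ℝ}
    (hw : Tendsto (fun j => ‖w j‖) atTop atTop)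
    (hJ : Tendsto (fun j => potentialEnergy lam P Q Φ (w j)) atTop (𝓝 c)) :
    Tendsto (fun j => P (‖w j‖⁻¹ • w j)) atTop (𝓝 0) := by
  rw [tendsto_zero_iff_norm_tendsto_zero]
  have hsq : Tendsto (fun j => ‖P (‖w j‖⁻¹ • w j)‖ ^ 2) atTop (𝓝 0) := by
    rw [Metric.tendsto_nhds]
    intro ε hε
    -- The part |λ|/2 absorbs the λ term of the energy; the part 2/ε then gives (2/ε)‖P w‖² < ½‖w‖²
    -- + const ≤ ‖w‖² for large j.
    obtain ⟨C, hC⟩ := hsuper (|lam| / 2 + 2 / ε)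
    have hbig : Tendsto (fun j => ‖w j‖ ^ 2) atTop atTop :=
      (tendsto_pow_atTop two_ne_zero).comp hw
    filter_upwards [hJ.eventually (lt_mem_nhds (sub_one_lt c)), hw.eventually_gt_atTop 0,
      hbig.eventually_ge_atTop (2 * (C - c + 1))] with j h1 h2 h3
    have h4 := hC (w j)
    have h5 : 2 / ε * ‖P (w j)‖ ^ 2 < ‖w j‖ ^ 2 := by
      rw [potentialEnergy] at h1
      have h6 : -(lam / 2) * ‖P (w j)‖ ^ 2 ≤ |lam| / 2 * ‖P (w j)‖ ^ 2 := by
        gcongr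
        linarith [neg_abs_le lam]
      nlinarith
    have h7 : ‖P (‖w j‖⁻¹ • w j)‖ ^ 2 = ‖P (w j)‖ ^ 2 / ‖w j‖ ^ 2 := by
      rw [map_smul, norm_smul, norm_inv, norm_norm, mul_pow, inv_pow, div_eq_inv_mul]
    have h8 : ‖P (w j)‖ ^ 2 ≤ ε / 2 * ‖w j‖ ^ 2 := by
      have := mul_le_mul_of_nonneg_left h5.le (half_pos hε).le
      rwa [← mul_assoc, show ε / 2 * (2 / ε) = 1 by field_simp, one_mul] at this
    rw [dist_zero_right, Real.norm_of_nonneg (by positivity), h7, div_lt_iff₀ (by positivity)]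
    nlinarith [pow_pos h2 2]
  simpa using hsq.sqrt

/-- Boundedness of Cerami sequences. -/
theorem exists_norm_le_of_cerami (hΦ : ∀ w, HasFDerivAt Φ (DΦ w) w)
    (hsuper : ∀ M : ℝ, ∃ C : ℝ, ∀ u, M * ‖P u‖ ^ 2 - C ≤ Φ (Q u))
    (hmono : ∃ C : ℝ, ∀ u, ∀ a : ℝ, 0 ≤ a → a ≤ 1 →
      Φ (Q u) - Φ (a • Q u) ≤ (1 - a ^ 2) / 2 * DΦ (Q u) (Q u) + C)
    (hinter : ∃ C a b : ℝ, 0 ≤ C ∧ 0 < a ∧ 0 ≤ b ∧ ∀ u, ‖Q u‖ ≤ C * ‖P u‖ ^ a * ‖u‖ ^ b)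
    {u : ℕ → V} {c : ℝ}
    (hJ : Tendsto (fun j => potentialEnergy lam P Q Φ (u j)) atTop (𝓝 c))
    (hD : Tendsto (fun j => (1 + ‖u j‖) * ‖fderiv ℝ (potentialEnergy lam P Q Φ) (u j)‖)
      atTop (𝓝 0)) :
    ∃ R : ℝ, ∀ j, ‖u j‖ ≤ R := by
  by_contra hR
  have hfreq : ∀ N : ℕ, ∃ᶠ j in atTop, (N : ℝ) ≤ ‖u j‖ := fun N hN => by
    have h1 : IsBoundedUnder (· ≤ ·) atTop (fun j => ‖u j‖) :=
      ⟨N, eventually_map.2 (hN.mono fun j hj => (not_le.1 hj).le)⟩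
    obtain ⟨R, hR'⟩ := h1.bddAbove_range
    exact hR ⟨R, fun j => hR' ⟨j, rfl⟩⟩
  obtain ⟨k, hk, hkN⟩ := extraction_forall_of_frequently hfreq
  set w := fun j => u (k j) with hwdef
  have hw : Tendsto (fun j => ‖w j‖) atTop atTop :=
    tendsto_atTop_mono hkN tendsto_natCast_atTop_atTop
  replace hJ : Tendsto (fun j => potentialEnergy lam P Q Φ (w j)) atTop (𝓝 c) :=
    hJ.comp hk.tendsto_atTop
  replace hD : Tendsto (fun j => (1 + ‖w j‖) * ‖fderiv ℝ (potentialEnergy lam P Q Φ) (w j)‖)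
      atTop (𝓝 0) := hD.comp hk.tendsto_atTop
  have hP := tendsto_map_normalized_zero hsuper hw hJ
  -- On unit vectors the factor ‖u‖^b of the interpolation inequality equals 1, so smallness of P
  -- forces smallness of Q.
  have hQ : Tendsto (fun j => Q (‖w j‖⁻¹ • w j)) atTop (𝓝 0) := by
    obtain ⟨C, a, b, hC, ha, hb, H⟩ := hinter
    have h1 : Tendsto (fun j => C * ‖P (‖w j‖⁻¹ • w j)‖ ^ a) atTop (𝓝 0) := by
      have := (tendsto_zero_iff_norm_tendsto_zero.1 hP).rpow_const (p := a) (Or.inr ha.le)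
      rw [Real.zero_rpow ha.ne'] at this
      simpa using this.const_mul C
    refine squeeze_zero_norm' ?_ h1
    filter_upwards [hw.eventually_gt_atTop 0] with j hj
    have h2 := H (‖w j‖⁻¹ • w j)
    rwa [norm_smul, norm_inv, norm_norm, inv_mul_cancel₀ hj.ne', Real.one_rpow, mul_one] at h2
  obtain ⟨C, hC⟩ := hmono
  -- The left side is the limit of J(r w_j/‖w_j‖), which is compared with J(w_j) by shrinking w_j by
  -- the factor a = r/‖w_j‖ ≤ 1.
  have hr : ∀ r : ℝ, 0 < r → 1 / 2 * r ^ 2 - Φ 0 ≤ c + C := fun r hr => by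
    have hlim : Tendsto (fun j => 1 / 2 * r ^ 2 - lam / 2 * (r * ‖P (‖w j‖⁻¹ • w j)‖) ^ 2 -
        Φ (r • Q (‖w j‖⁻¹ • w j))) atTop (𝓝 (1 / 2 * r ^ 2 - Φ 0)) := by
      have h1 := (((tendsto_zero_iff_norm_tendsto_zero.1 hP).const_mul r).pow 2).const_mul (lam / 2)
      have h2 := hQ.const_smul r
      rw [smul_zero] at h2
      have h3 := (hΦ 0).continuousAt.tendsto.comp h2
      have := (h1.const_sub (1 / 2 * r ^ 2)).sub h3
      simpa using this
    have hrhs : Tendsto (fun j => potentialEnergy lam P Q Φ (w j) +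
        (1 + ‖w j‖) * ‖fderiv ℝ (potentialEnergy lam P Q Φ) (w j)‖ + C) atTop
        (𝓝 (c + C)) := by
      simpa using (hJ.add hD).add_const C
    refine le_of_tendsto_of_tendsto hlim hrhs ?_
    filter_upwards [hw.eventually_ge_atTop r] with j hj
    have hN : 0 < ‖w j‖ := hr.trans_le hj
    set a := r * ‖w j‖⁻¹ with ha
    have ha0 : 0 ≤ a := by positivity
    have ha1 : a ≤ 1 := by
      rw [ha, ← div_eq_mul_inv]; exact (div_le_one hN).2 hj
    have h1 := hC (w j) a ha0 ha1
    have h2 := fderiv_potentialEnergy_apply (lam := lam) (P := P) (Q := Q) hΦ (w j) (w j)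
    rw [real_inner_self_eq_norm_sq, real_inner_self_eq_norm_sq] at h2
    have h3 := (fderiv ℝ (potentialEnergy lam P Q Φ) (w j)).le_opNorm (w j)
    set G := ‖fderiv ℝ (potentialEnergy lam P Q Φ) (w j)‖
    have hG : 0 ≤ G := norm_nonneg _
    rw [h2, Real.norm_eq_abs] at h3
    have e1 : r • Q (‖w j‖⁻¹ • w j) = a • Q (w j) := by rw [map_smul, smul_smul]
    have e2 : r * ‖P (‖w j‖⁻¹ • w j)‖ = a * ‖P (w j)‖ := by
      rw [map_smul, norm_smul, norm_inv, norm_norm, ha, mul_assoc]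
    have e3 : r = a * ‖w j‖ := by rw [ha]; field_simp
    have e4 : 1 / 2 * r ^ 2 = 1 / 2 * (a * ‖w j‖) ^ 2 := by rw [← e3]
    rw [e1, e2, e4, potentialEnergy]
    have h4 := neg_abs_le (‖w j‖ ^ 2 - lam * ‖P (w j)‖ ^ 2 - DΦ (Q (w j)) (Q (w j)))
    have h5 : 0 ≤ (1 - a ^ 2) / 2 := by nlinarith
    have h6 : (1 - a ^ 2) / 2 ≤ 1 := by nlinarith
    have h7 : -(G * ‖w j‖) ≤
        (1 - a ^ 2) / 2 * (‖w j‖ ^ 2 - lam * ‖P (w j)‖ ^ 2 - DΦ (Q (w j)) (Q (w j))) := by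
      nlinarith [mul_nonneg hG hN.le]
    nlinarith
  -- This r satisfies r ≥ 2, so r²/2 ≥ r > c + C + Φ(0), contradicting the bound.
  have h1 := hr (|c + C + Φ 0| + 2) (by positivity)
  nlinarith [le_abs_self (c + C + Φ 0), abs_nonneg (c + C + Φ 0)]

/-- Bounded Palais–Smale sequences have convergent subsequences when the lower order terms are
compact. -/
theorem exists_tendsto_subseq_of_bounded [CompleteSpace V] (hΦ : ∀ w, HasFDerivAt Φ (DΦ w) w)
    (hbdd : ∀ R : ℝ, ∃ C : ℝ, ∀ w, ‖w‖ ≤ R → ‖DΦ w‖ ≤ C)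
    (hcomp : ∀ (u : ℕ → V) (R : ℝ), (∀ j, ‖u j‖ ≤ R) → ∃ k : ℕ → ℕ, StrictMono k ∧
      CauchySeq (fun j => P (u (k j))) ∧ CauchySeq (fun j => Q (u (k j))))
    {u : ℕ → V} {R : ℝ} (hu : ∀ j, ‖u j‖ ≤ R)
    (hD : Tendsto (fun j => ‖fderiv ℝ (potentialEnergy lam P Q Φ) (u j)‖) atTop (𝓝 0)) :
    ∃ (k : ℕ → ℕ) (v : V), StrictMono k ∧ Tendsto (fun j => u (k j)) atTop (𝓝 v) := by
  obtain ⟨k, hk, hP, hQ⟩ := hcomp u R hu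
  suffices CauchySeq fun j => u (k j) by
    obtain ⟨v, hv⟩ := cauchySeq_tendsto_of_complete this
    exact ⟨k, v, hk, hv⟩
  obtain ⟨C, hC⟩ := hbdd (‖Q‖ * R)
  have hCQ : ∀ j, ‖DΦ (Q (u j))‖ ≤ C := fun j => hC _ ((Q.le_opNorm _).trans (by gcongr; exact hu j))
  set G : ℕ → ℝ := fun j => ‖fderiv ℝ (potentialEnergy lam P Q Φ) (u (k j))‖ with hG
  have hG0 : Tendsto G atTop (𝓝 0) := hD.comp hk.tendsto_atTop
  rw [cauchySeq_iff_tendsto_dist_atTop_0] at hP hQ ⊢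
  have hfst : Tendsto (fun p : ℕ × ℕ => G p.1) atTop (𝓝 0) := by
    rw [← prod_atTop_atTop_eq]; exact hG0.comp tendsto_fst
  have hsnd : Tendsto (fun p : ℕ × ℕ => G p.2) atTop (𝓝 0) := by
    rw [← prod_atTop_atTop_eq]; exact hG0.comp tendsto_snd
  have hlim := ((((hfst.add hsnd).mul_const (2 * R)).add ((hP.pow 2).const_mul |lam|)).add
    (hQ.const_mul (2 * C))).sqrt
  simp only [add_zero, zero_mul, mul_zero, zero_pow two_ne_zero, Real.sqrt_zero] at hlim
  refine squeeze_zero (fun p => dist_nonneg) (fun p => Real.le_sqrt_of_sq_le ?_) hlim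
  set x := u (k p.1) with hx
  set y := u (k p.2) with hy
  have h1 := fderiv_potentialEnergy_apply (lam := lam) (P := P) (Q := Q) hΦ x (x - y)
  have h2 := fderiv_potentialEnergy_apply (lam := lam) (P := P) (Q := Q) hΦ y (x - y)
  have hxy : ‖x - y‖ ≤ 2 * R := by
    have := norm_sub_le x y
    linarith [hu (k p.1), hu (k p.2)]
  -- The estimate rests on ‖x − y‖² = (J'(x) − J'(y))(x − y) + λ‖P(x − y)‖² + (DΦ(Qx) − DΦ(Qy))(Q(x
  -- − y)), each term of which tends to zero along the subsequence.
  have e1 : ‖x - y‖ ^ 2 = inner ℝ x (x - y) - inner ℝ y (x - y) := by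
    rw [← inner_sub_left, real_inner_self_eq_norm_sq]
  have e2 : ‖P x - P y‖ ^ 2 = inner ℝ (P x) (P (x - y)) - inner ℝ (P y) (P (x - y)) := by
    rw [← inner_sub_left, map_sub, real_inner_self_eq_norm_sq]
  have h3 := abs_le.1 ((fderiv ℝ (potentialEnergy lam P Q Φ) x).le_of_opNorm_le_of_le le_rfl hxy)
  have h4 := abs_le.1 ((fderiv ℝ (potentialEnergy lam P Q Φ) y).le_of_opNorm_le_of_le le_rfl hxy)
  have h5 := abs_le.1 ((DΦ (Q x)).le_of_opNorm_le_of_le (hCQ (k p.1)) (le_refl ‖Q (x - y)‖))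
  have h6 := abs_le.1 ((DΦ (Q y)).le_of_opNorm_le_of_le (hCQ (k p.2)) (le_refl ‖Q (x - y)‖))
  have h7 : lam * ‖P x - P y‖ ^ 2 ≤ |lam| * ‖P x - P y‖ ^ 2 := by
    gcongr
    exact le_abs_self lam
  rw [dist_eq_norm, dist_eq_norm, dist_eq_norm, ← map_sub Q x y]
  rw [e2] at h7 ⊢
  rw [e1]
  simp only [hG]
  rw [← hx, ← hy]
  linarith [h3.1, h3.2, h4.1, h4.2, h5.1, h5.2, h6.1, h6.2]

theorem ceramiCondition_potentialEnergy [CompleteSpace V] (hΦ : ∀ w, HasFDerivAt Φ (DΦ w) w)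
    (hsuper : ∀ M : ℝ, ∃ C : ℝ, ∀ u, M * ‖P u‖ ^ 2 - C ≤ Φ (Q u))
    (hmono : ∃ C : ℝ, ∀ u, ∀ a : ℝ, 0 ≤ a → a ≤ 1 →
      Φ (Q u) - Φ (a • Q u) ≤ (1 - a ^ 2) / 2 * DΦ (Q u) (Q u) + C)
    (hinter : ∃ C a b : ℝ, 0 ≤ C ∧ 0 < a ∧ 0 ≤ b ∧ ∀ u, ‖Q u‖ ≤ C * ‖P u‖ ^ a * ‖u‖ ^ b)
    (hbdd : ∀ R : ℝ, ∃ C : ℝ, ∀ w, ‖w‖ ≤ R → ‖DΦ w‖ ≤ C)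
    (hcomp : ∀ (u : ℕ → V) (R : ℝ), (∀ j, ‖u j‖ ≤ R) → ∃ k : ℕ → ℕ, StrictMono k ∧
      CauchySeq (fun j => P (u (k j))) ∧ CauchySeq (fun j => Q (u (k j)))) (c : ℝ) :
    CeramiCondition (potentialEnergy lam P Q Φ) c := by
  intro u hJ hD
  have hD' : Tendsto (fun j => (1 + ‖u j‖) * ‖fderiv ℝ (potentialEnergy lam P Q Φ) (u j)‖)
      atTop (𝓝 0) := by
    refine squeeze_zero (fun j => by positivity) (fun j => ?_) hD
    gcongr
    exact norm_le_sSup_unit _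
  obtain ⟨R, hR⟩ := exists_norm_le_of_cerami hΦ hsuper hmono hinter hJ hD'
  refine exists_tendsto_subseq_of_bounded (lam := lam) hΦ hbdd hcomp hR ?_
  refine squeeze_zero (fun j => norm_nonneg _) (fun j => ?_) hD'
  exact le_mul_of_one_le_left (norm_nonneg _) (by linarith [norm_nonneg (u j)])

end Abstract

end

/-! ### Pointwise consequences of the hypotheses on f. -/

section

/-- With c = g(t)/t, monotonicity gives g(τ) ≤ cτ on [b, t], and the integral of cτ over [at, t] is
exactly (1 − a²)/2 · g(t)t. Below b only |g| ≤ M is known, and this accounts for the error 2Mb. -/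
theorem integral_le_of_ratio_monotone {g : ℝ → ℝ} (hg : Continuous g) {b M : ℝ} (hb : 0 < b)
    (hM : ∀ t, |t| ≤ b → |g t| ≤ M) (hmono : MonotoneOn (fun t => g t / t) (Set.Ici b))
    {t a : ℝ} (ht : 0 ≤ t) (ha0 : 0 ≤ a) (ha1 : a ≤ 1) :
    ∫ τ in (a * t)..t, g τ ≤ (1 - a ^ 2) / 2 * (g t * t) + 2 * M * b := by
  have hM0 : 0 ≤ M := (abs_nonneg _).trans (hM 0 (by simpa using hb.le))
  have hat0 : 0 ≤ a * t := by positivity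
  have hat : a * t ≤ t := mul_le_of_le_one_left ht ha1
  have hi : ∀ x y, IntervalIntegrable g volume x y := fun x y => hg.intervalIntegrable x y
  have ha2 : 0 ≤ (1 - a ^ 2) / 2 := by nlinarith
  have ha3 : (1 - a ^ 2) / 2 ≤ 1 / 2 := by nlinarith
  rcases lt_or_ge t b with htb | htb
  · have h1 : ∫ τ in (a * t)..t, g τ ≤ ∫ _ in (a * t)..t, M :=
      intervalIntegral.integral_mono_on hat (hi _ _) intervalIntegrable_const fun τ hτ =>
        (abs_le.1 (hM τ (abs_le.2 ⟨by linarith [hτ.1], by linarith [hτ.2]⟩))).2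
    rw [intervalIntegral.integral_const, smul_eq_mul] at h1
    have h2 := abs_le.1 (hM t (by rw [abs_of_nonneg ht]; exact htb.le))
    have h3 : -(M * b) ≤ g t * t := by nlinarith
    have h4 : -(M * b) ≤ (1 - a ^ 2) / 2 * (g t * t) := by
      nlinarith [mul_nonneg hM0 hb.le]
    nlinarith
  · set c := g t / t with hc
    have ht0 : 0 < t := hb.trans_le htb
    -- If c is negative, monotonicity still keeps it above g(b)/b ≥ −M/b, hence cτ ≥ −M for 0 ≤ τ ≤
    -- b and g ≤ cτ + 2M there.
    have hcb : -M ≤ c * b := by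
      have h1 : g b / b ≤ c := hmono (Set.mem_Ici.2 le_rfl) (Set.mem_Ici.2 htb) htb
      have h2 := (abs_le.1 (hM b (by rw [abs_of_pos hb]))).1
      rw [div_le_iff₀ hb] at h1
      linarith
    have hlin : ∀ x y : ℝ, ∫ τ in x..y, c * τ = c * ((y ^ 2 - x ^ 2) / 2) := fun x y => by
      rw [intervalIntegral.integral_const_mul, integral_id]
    have hlinI : ∀ x y : ℝ, IntervalIntegrable (fun τ => c * τ) volume x y := fun x y =>
      (continuous_const.mul continuous_id).intervalIntegrable x y
    have hbig : ∀ x, b ≤ x → x ≤ t → ∫ τ in x..t, g τ ≤ ∫ τ in x..t, c * τ := fun x hx hxt =>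
      intervalIntegral.integral_mono_on hxt (hi _ _) (hlinI _ _) fun τ hτ => by
        have h1 : g τ / τ ≤ c :=
          hmono (Set.mem_Ici.2 (hx.trans hτ.1)) (Set.mem_Ici.2 htb) hτ.2
        rwa [div_le_iff₀ (hb.trans_le (hx.trans hτ.1))] at h1
    have hgt : g t * t = c * t ^ 2 := by rw [hc]; field_simp
    have hMb : 0 ≤ M * b := by positivity
    rcases le_or_gt b (a * t) with hab | hab
    · have h1 := hbig _ hab hat
      rw [hlin] at h1
      rw [hgt]
      nlinarith
    · have h1 := hbig b le_rfl htb
      have h2 : ∫ τ in (a * t)..b, g τ ≤ ∫ τ in (a * t)..b, (c * τ + 2 * M) :=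
        intervalIntegral.integral_mono_on hab.le (hi _ _)
          ((hlinI _ _).add intervalIntegrable_const) fun τ hτ => by
            have h3 := (abs_le.1 (hM τ (abs_le.2 ⟨by linarith [hτ.1], hτ.2⟩))).2
            have h4 : -M ≤ c * τ := by
              rcases le_or_gt 0 c with h | h
              · nlinarith [mul_nonneg h (hat0.trans hτ.1)]
              · nlinarith [hτ.2]
            linarith
      rw [intervalIntegral.integral_add (hlinI _ _) intervalIntegrable_const, hlin,
        intervalIntegral.integral_const, smul_eq_mul] at h2
      rw [hlin] at h1
      rw [← intervalIntegral.integral_add_adjacent_intervals (hi (a * t) b) (hi b t), hgt]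
      nlinarith [mul_nonneg hM0 hat0]

variable {n : ℕ} {s : ℝ} {Ω : Set (E n)} {K : E n → ℝ} {f : E n → ℝ → ℝ} {a₁ a₂ q : ℝ}

/-- The consequence of the monotonicity of `f(x,t)/t` used to compare the energy of `u` with that
of `au` for `a ∈ [0,1]`. -/
theorem exists_primitive_sub_le (hf : Continuous (Function.uncurry f)) (hq : 1 < q)
    (ha₂ : 0 ≤ a₂) (hgrowth : ∀ x ∈ Ω, ∀ t : ℝ, |f x t| ≤ a₁ + a₂ * |t| ^ (q - 1))
    (hmono : EventuallyMonotoneRatio Ω f) :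
    ∃ C : ℝ, ∀ x ∈ Ω, ∀ t a : ℝ, 0 ≤ a → a ≤ 1 →
      primitive f x t - primitive f x (a * t) ≤ (1 - a ^ 2) / 2 * (f x t * t) + C := by
  obtain ⟨b, hb, hmono⟩ := hmono
  refine ⟨2 * (a₁ + a₂ * b ^ (q - 1)) * b, fun x hx t a ha0 ha1 => ?_⟩
  have hM : ∀ τ : ℝ, |τ| ≤ b → |f x τ| ≤ a₁ + a₂ * b ^ (q - 1) := fun τ hτ => by
    refine (hgrowth x hx τ).trans ?_
    have := Real.rpow_le_rpow (abs_nonneg τ) hτ (sub_nonneg.2 hq.le)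
    nlinarith
  have hc : Continuous (f x) := hf.comp (Continuous.prodMk_right x)
  rw [primitive_sub hf]
  rcases le_total 0 t with ht | ht
  · exact integral_le_of_ratio_monotone hc hb hM (hmono x hx).1 ht ha0 ha1
  -- For t ≤ 0, reflect: the ratio of τ ↦ −f(x, −τ) to τ is f(x, −τ)/(−τ), so antitonicity on (−∞,
  -- −b] becomes monotonicity on [b, ∞).
  · have h1 := integral_le_of_ratio_monotone (g := fun τ => -f x (-τ)) (by fun_prop) hb
      (fun τ hτ => by rw [abs_neg]; exact hM _ (by rwa [abs_neg]))
      (fun y hy z hz hyz => by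
        have := (hmono x hx).2 (by simpa using hz : -z ∈ Set.Iic (-b))
          (by simpa using hy : -y ∈ Set.Iic (-b)) (neg_le_neg hyz)
        simpa only [div_neg, neg_div] using this)
      (neg_nonneg.2 ht) ha0 ha1
    rw [intervalIntegral.integral_neg, intervalIntegral.integral_comp_neg (fun τ => f x τ),
      ← intervalIntegral.integral_symm, neg_neg, mul_neg, neg_neg] at h1
    linarith

/-- Superquadratic growth bounds the primitive from below by any quadratic, up to a constant. -/
theorem exists_le_primitive (hf : Continuous (Function.uncurry f)) (hq : 1 < q)
    (ha₂ : 0 ≤ a₂) (hgrowth : ∀ x ∈ Ω, ∀ t : ℝ, |f x t| ≤ a₁ + a₂ * |t| ^ (q - 1))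
    (hsuper : Superquadratic Ω f) (M : ℝ) :
    ∃ C : ℝ, ∀ x ∈ Ω, ∀ t : ℝ, M * t ^ 2 - C ≤ primitive f x t := by
  obtain ⟨R, hR, H⟩ := hsuper M
  refine ⟨|M| * R ^ 2 + |a₁ + a₂ * R ^ (q - 1)| * R, fun x hx t => ?_⟩
  have hC : 0 ≤ |M| * R ^ 2 + |a₁ + a₂ * R ^ (q - 1)| * R := by positivity
  rcases le_or_gt R |t| with ht | ht
  · have h1 := H x (subset_closure hx) t ht
    have ht0 : 0 < |t| := hR.trans_le ht
    rw [le_div_iff₀ (by positivity), sq_abs] at h1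
    linarith
  · have h1 := abs_primitive_sub_le hf hq ha₂ (hgrowth x hx) (a := 0) (b := t) (S := R)
      (by simpa using hR.le) ht.le
    have h0 : primitive f x 0 = 0 := by simp [primitive]
    rw [h0, sub_zero, sub_zero] at h1
    have h2 := neg_abs_le (primitive f x t)
    have h3 : (a₁ + a₂ * R ^ (q - 1)) * |t| ≤ |a₁ + a₂ * R ^ (q - 1)| * R := by
      gcongr
      exact le_abs_self _
    have h4 : M * t ^ 2 ≤ |M| * R ^ 2 := by
      rw [← sq_abs t]
      gcongr
      exact le_abs_self _
    linarith

/-! ### Extension of f and verification of the abstract hypotheses. -/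

/-- A nonlinearity continuous on `closure Ω × ℝ` is the restriction of one continuous everywhere. -/
theorem exists_continuous_extension
    (hf : ContinuousOn (Function.uncurry f) (closure Ω ×ˢ Set.univ)) :
    ∃ g : E n → ℝ → ℝ, Continuous (Function.uncurry g) ∧ ∀ x ∈ closure Ω, g x = f x := by
  have hcl : IsClosed (closure Ω ×ˢ (Set.univ : Set ℝ)) := isClosed_closure.prod isClosed_univ
  -- Tietze's extension theorem on the closed set closure Ω × ℝ.
  obtain ⟨g, hg⟩ := ContinuousMap.exists_restrict_eq hcl
    ⟨_, continuousOn_iff_continuous_domRestrict.1 hf⟩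
  refine ⟨fun x t => g (x, t), g.continuous, fun x hx => funext fun t => ?_⟩
  exact DFunLike.congr_fun hg ⟨(x, t), hx, Set.mem_univ t⟩

variable {h : Setting n s Ω K}

theorem primitive_congr {g : E n → ℝ → ℝ} {x : E n} (hx : g x = f x) :
    primitive g x = primitive f x := by
  funext t; simp only [primitive, hx]

theorem energy_congr {g : E n → ℝ → ℝ} (hgf : ∀ x ∈ Ω, g x = f x) (lam : ℝ) :
    energy h lam g = energy h lam f := by
  funext u
  simp only [energy]
  congr 1
  exact setIntegral_congr_fun h.isOpen.measurableSet fun x hx => by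
    simp only [primitive_congr (hgf x hx)]

theorem norm_toLp_two_sq (u : X0 h) :
    ‖X0.toLp h 2 h.two_le_critExp u‖ ^ 2 = ∫ x in Ω, |u x| ^ 2 := by
  rw [← real_inner_self_eq_norm_sq, L2.inner_def]
  refine integral_congr_ae ?_
  filter_upwards [X0.coeFn_toLp h.two_le_critExp u] with x hx
  rw [hx, RCLike.inner_apply, conj_trivial, sq_abs, sq]

theorem energy_eq_potentialEnergy [Fact (1 ≤ ENNReal.ofReal q)]
    (hqc : ENNReal.ofReal q ≤ critExp n s) (lam : ℝ) :
    energy h lam f = potentialEnergy lam (X0.toLp h 2 h.two_le_critExp)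
      (X0.toLp h (ENNReal.ofReal q) hqc) (fun v => ∫ x in Ω, primitive f x (v x)) := by
  funext u
  rw [energy, potentialEnergy, norm_toLp_two_sq, ← X0.norm_sq]
  congr 1
  refine integral_congr_ae ?_
  filter_upwards [X0.coeFn_toLp hqc u] with x hx
  rw [hx]

/-- The Cerami condition and differentiability for a nonlinearity that is continuous everywhere. -/
theorem differentiable_energy_and_cerami (h : Setting n s Ω K)
    (hf : Continuous (Function.uncurry f)) (ha₁ : 0 ≤ a₁) (ha₂ : 0 ≤ a₂) (h2q : 2 < q)
    (hq : q < 2 * n / (n - 2 * s))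
    (hgrowth : ∀ x ∈ Ω, ∀ t : ℝ, |f x t| ≤ a₁ + a₂ * |t| ^ (q - 1))
    (hsuper : Superquadratic Ω f) (hmono : EventuallyMonotoneRatio Ω f) (lam : ℝ) :
    (∀ u : X0 h, IntegrableOn (fun x => primitive f x (u x)) Ω) ∧
      Differentiable ℝ (energy h lam f) ∧ ∀ c : ℝ, CeramiCondition (energy h lam f) c := by
  have := h.isFiniteMeasure_restrict
  have hΩ := h.isOpen.measurableSet
  have hq1 : 1 < q := by linarith
  have hqc : ENNReal.ofReal q ≤ critExp n s := ENNReal.ofReal_le_ofReal hq.le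
  -- Growth is only needed almost everywhere for the restricted measure, so an extension of f need
  -- not obey it outside Ω.
  have hpow : PowerGrowth (volume.restrict Ω) f a₁ a₂ q :=
    ⟨hf, ha₁, ha₂, hq1, (ae_restrict_iff' hΩ).2 (ae_of_all _ hgrowth)⟩
  have : Fact (1 ≤ ENNReal.ofReal q) := ⟨hpow.one_le_ofReal⟩
  have hint : ∀ u : X0 h, IntegrableOn (fun x => primitive f x (u x)) Ω := fun u =>
    hpow.integrable_primitive_comp (u.memLp_restrict hqc)
  have hΦ := fun w => hpow.hasFDerivAt_potential w
  have hintL := fun w : Lp ℝ (ENNReal.ofReal q) (volume.restrict Ω) =>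
    hpow.integrable_primitive_comp (Lp.memLp w)
  rw [energy_eq_potentialEnergy hqc]
  refine ⟨hint, fun u => (hasFDerivAt_potentialEnergy hΦ u).differentiableAt, fun c =>
    ceramiCondition_potentialEnergy hΦ (fun M => ?_) ?_
      (exists_norm_toLp_le_interpolation h h2q hq hqc) hpow.exists_norm_derivPotential_le
      (fun u R hu => exists_subseq_cauchySeq_toLp h h2q hq hqc u hu) c⟩
  · obtain ⟨C, hC⟩ := exists_le_primitive hf hq1 ha₂ hgrowth hsuper M
    refine ⟨C * (volume.restrict Ω).real Set.univ, fun u => ?_⟩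
    have hu2 : Integrable (fun x => |u x| ^ 2) (volume.restrict Ω) := by
      simpa only [sq_abs] using u.memX0.memLp.integrable_sq
    calc M * ‖X0.toLp h 2 h.two_le_critExp u‖ ^ 2 - C * (volume.restrict Ω).real Set.univ
        = ∫ x in Ω, (M * |u x| ^ 2 - C) := by
          rw [integral_sub (hu2.const_mul M) (integrable_const C), integral_const_mul,
            norm_toLp_two_sq, integral_const, smul_eq_mul, mul_comm C]
      _ ≤ ∫ x in Ω, primitive f x (X0.toLp h (ENNReal.ofReal q) hqc u x) := by
          refine integral_mono_ae ((hu2.const_mul M).sub (integrable_const C)) (hintL _) ?_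
          filter_upwards [X0.coeFn_toLp hqc u, ae_restrict_mem hΩ] with x hx hxΩ
          rw [hx, sq_abs]
          exact hC x hxΩ (u x)
  · obtain ⟨C, hC⟩ := exists_primitive_sub_le hf hq1 ha₂ hgrowth hmono
    refine ⟨C * (volume.restrict Ω).real Set.univ, fun u a ha0 ha1 => ?_⟩
    set w := X0.toLp h (ENNReal.ofReal q) hqc u
    have hfw : Integrable (fun x => f x (w x) * w x) (volume.restrict Ω) := by
      have := dualExp_holderConjugate hq1
      exact ((Lp.memLp w).integrable_mul (hpow.memLp_comp (Lp.memLp w))).congr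
        (ae_of_all _ fun x => mul_comm _ _)
    rw [hpow.derivPotential_apply, ← integral_sub (hintL w) (hintL (a • w))]
    calc ∫ x in Ω, (primitive f x (w x) - primitive f x ((a • w) x))
        ≤ ∫ x in Ω, ((1 - a ^ 2) / 2 * (f x (w x) * w x) + C) := by
          refine integral_mono_ae ((hintL w).sub (hintL (a • w)))
            ((hfw.const_mul _).add (integrable_const C)) ?_
          filter_upwards [Lp.coeFn_smul a w, ae_restrict_mem hΩ] with x hx hxΩ
          rw [hx]
          exact hC x hxΩ (w x) a ha0 ha1
      _ = _ := by
          rw [integral_add (hfw.const_mul _) (integrable_const C), integral_const_mul,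
            integral_const, smul_eq_mul, mul_comm C]

end

end Nonlocal

end

theorem proposition4p3 (n : ℕ) (s : ℝ) (Ω : Set (EuclideanSpace ℝ (Fin n)))
    (K : EuclideanSpace ℝ (Fin n) → ℝ) (h : Nonlocal.Setting n s Ω K)
    (f : EuclideanSpace ℝ (Fin n) → ℝ → ℝ)
    (hf : ContinuousOn (Function.uncurry f) (closure Ω ×ˢ Set.univ))
    (hgrowth : Nonlocal.SubcriticalGrowth s Ω f)
    (hsuper : Nonlocal.Superquadratic Ω f)
    (hmono : Nonlocal.EventuallyMonotoneRatio Ω f)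
    (lam : ℝ) :
    (∀ u : Nonlocal.X0 h, IntegrableOn (fun x => |u x| ^ 2) Ω ∧
      IntegrableOn (fun x => Nonlocal.primitive f x (u x)) Ω) ∧
    Differentiable ℝ (Nonlocal.energy h lam f) ∧
    ∀ c : ℝ, Nonlocal.CeramiCondition (Nonlocal.energy h lam f) c := by
  obtain ⟨a₁, a₂, q, ha₁, ha₂, h2q, hq, hgr⟩ := hgrowth
  obtain ⟨b, hb, hmono⟩ := hmono
  -- Joint continuity on the whole space makes compositions measurable. The energy reads the
  -- nonlinearity only over Ω and the superquadratic condition only over closure Ω, so replacing f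
  -- by g changes neither.
  obtain ⟨g, hg, hgf⟩ := Nonlocal.exists_continuous_extension hf
  have hgΩ : ∀ x ∈ Ω, g x = f x := fun x hx => hgf x (subset_closure hx)
  have key := Nonlocal.differentiable_energy_and_cerami h hg ha₁.le ha₂.le h2q hq
    (fun x hx => by rw [hgΩ x hx]; exact hgr x hx)
    (fun M => by
      obtain ⟨R, hR, H⟩ := hsuper M
      refine ⟨R, hR, fun x hx => ?_⟩
      rw [Nonlocal.primitive_congr (hgf x hx)]
      exact H x hx)
    ⟨b, hb, fun x hx => by rw [hgΩ x hx]; exact hmono x hx⟩ lam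
  rw [Nonlocal.energy_congr hgΩ] at key
  refine ⟨fun u => ⟨?_, ?_⟩, key.2⟩
  · rw [IntegrableOn]
    simpa only [sq_abs] using u.memX0.memLp.integrable_sq
  · refine (key.1 u).congr_fun (fun x hx => ?_) h.isOpen.measurableSet
    simp only [Nonlocal.primitive_congr (hgΩ x hx)]
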